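/- Let $n\ge 2$ and let $\mathcal O_n$ be the Cuntz algebra, the universal $C^*$-algebra generated by isometries $S_1,\dots,S_n$ with $\sum_{i=1}^n S_iS_i^*=1$. For a multi-index $\mu=(\mu_1,\dots,\mu_k)\in\{1,\dots,n\}^k$ put $|\mu|=k$, $S_\mu=S_{\mu_1}\cdots S_{\mu_k}$ (with $S_\emptyset=1$) and $P_\mu=S_\mu S_\mu^*$. Let $\mathcal F_n^k=\operatorname{span}\{S_\mu S_\nu^*: |\mu|=|\nu|=k\}$, let $\mathcal F_n=\overline{\bigcup_k\mathcal F_n^k}$ be the core UHF-subalgebra, with its unique normalized trace $\tau$, let $\mathcal D_n\subseteq\mathcal F_n$ be the $C^*$-subalgebra generated by all projections $P_\mu$, and put $\mathcal D_n^1=\mathcal D_n\cap\mathcal F_n^1$. Let $\varphi(x)=\sum_{i=1}^n S_ixS_i^*$ be the canonical shift, which maps $\mathcal D_n$ into itself. For a unitary $u\in\mathcal O_n$ let $\lambda_u$ be the unital $*$-endomorphism of $\mathcal O_n$ with $\lambda_u(S_i)=uS_i$ for $i=1,\dots,n$. Let $\mathcal P_n$ be the set of permutation unitaries, that is, of the unitaries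 $u\in\mathcal F_n$ of the form $u=\sum_{j=1}^m S_{\mu_j}S_{\nu_j}^*$ for finitely many multi-indices $\mu_j,\nu_j$. An automorphism $\beta$ of $\mathcal D_n$ has property (P) if there is $m\ge 0$ such that $$\beta\varphi^k(x)=\varphi^{k-m}\beta\varphi^m(x)\qquad\text{for all }k\ge m\text{ and all }x\in\mathcal D_n^1 .$$ **Theorem.** Let $\alpha$ be a ($*$-)automorphism of $\mathcal D_n$. The following conditions are equivalent: (1) $\alpha^{-1}$ has property (P); (2) there is $u\in\mathcal P_n$ such that $\alpha=\lambda_u|_{\mathcal D_n}$. In this case, $\alpha$ extends to a unital $*$-endomorphism of $\mathcal F_n$, and both $\alpha$ and $\alpha^{-1}$ preserve $\tau$, that is, $\tau(\alpha(x))=\tau(x)=\tau(\alpha^{-1}(x))$ for all $x\in\mathcal D_n$. -/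

import Mathlib

open scoped ENNReal ComplexOrder

noncomputable section

namespace Cuntz

/-! ### The Cuntz algebra as a universal C*-algebra

`𝒪_n` is the universal C*-algebra generated by `n` isometries `S_1, …, S_n` with
`∑ S_i S_i^* = 1`. It is realised as the C*-algebra generated by the direct sum of all families
of such isometries on the separable Hilbert space `ℓ²(ℕ)`. (Every C*-algebra generated by such a
family is separable, hence embeds into the bounded operators on `ℓ²(ℕ)`, so this direct sum
is the universal one.) -/

/-- The Hilbert space `ℓ²(ℕ)`. -/
abbrev Hilb : Type := lp (fun _ : ℕ => ℂ) 2

instance : Nontrivial Hilb :=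
  ⟨lp.single 2 0 (1 : ℂ), 0, fun h => by
    have := congrArg (fun f : Hilb => f 0) h
    simp at this⟩

/-- A family of `n` isometries `T_i` on `ℓ²(ℕ)` with `∑ T_i T_i^* = 1`. -/
structure Family (n : ℕ) where
  /-- the operators -/
  op : Fin n → (Hilb →L[ℂ] Hilb)
  isometry : ∀ i, star (op i) * op i = 1
  sum_range : ∑ i, op i * star (op i) = 1

/-- The C*-algebra of all bounded operator-valued functions on the set of Cuntz families
(the `ℓ^∞`-product of copies of `B(ℓ²(ℕ))`). -/
def Product (n : ℕ) : Type := lp (fun _ : Family n => Hilb →L[ℂ] Hilb) ∞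

instance (n : ℕ) : CStarAlgebra (Product n) :=
  let _ : CStarAlgebra (lp (fun _ : Family n => Hilb →L[ℂ] Hilb) ∞) := {}
  inferInstanceAs (CStarAlgebra (lp (fun _ : Family n => Hilb →L[ℂ] Hilb) ∞))

namespace Product

variable {n : ℕ}

/-- Evaluation of an element of the product at a Cuntz family. -/
def eval (T : Family n) : Product n →⋆ₐ[ℂ] (Hilb →L[ℂ] Hilb) where
  toFun x := x.1 T
  map_one' := rfl
  map_mul' _ _ := rfl
  map_zero' := rfl
  map_add' _ _ := rfl
  commutes' _ := rfl
  map_star' _ := rfl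

theorem ext {x y : Product n} (h : ∀ T, eval T x = eval T y) : x = y :=
  Subtype.ext (funext h)

/-- A uniformly bounded operator-valued function on Cuntz families. -/
def mk (f : Family n → (Hilb →L[ℂ] Hilb)) (C : ℝ) (hf : ∀ T, ‖f T‖ ≤ C) : Product n :=
  ⟨f, memℓp_infty ⟨C, by rintro _ ⟨T, rfl⟩; exact hf T⟩⟩

@[simp]
theorem eval_mk (f : Family n → (Hilb →L[ℂ] Hilb)) (C : ℝ) (hf : ∀ T, ‖f T‖ ≤ C)
    (T : Family n) : eval T (mk f C hf) = f T := rfl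

theorem norm_eval_le (T : Family n) (x : Product n) : ‖eval T x‖ ≤ ‖x‖ :=
  NonUnitalStarAlgHom.norm_apply_le (eval T) x

theorem Family.norm_op_le (T : Family n) (i : Fin n) : ‖T.op i‖ ≤ 1 := by
  have h := CStarRing.norm_star_mul_self (x := T.op i)
  rw [T.isometry i, norm_one] at h
  nlinarith

/-- The universal family of isometries: the `i`-th generator takes the value `T_i` at the
family `T`. -/
def gen (i : Fin n) : Product n := mk (fun T => T.op i) 1 fun T => Family.norm_op_le T i

/-- Composition with a self-map of the set of Cuntz families. -/
def reindex (f : Family n → Family n) : Product n →⋆ₐ[ℂ] Product n where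
  toFun x := mk (fun T => eval (f T) x) ‖x‖ fun T => norm_eval_le (f T) x
  map_one' := ext fun T => by simp
  map_mul' _ _ := ext fun T => by simp
  map_zero' := ext fun T => by simp
  map_add' _ _ := ext fun T => by simp
  commutes' r := ext fun T => by simp [AlgHomClass.commutes]
  map_star' _ := ext fun T => by simp [map_star]

@[simp]
theorem eval_reindex (f : Family n → Family n) (x : Product n) (T : Family n) :
    eval T (reindex f x) = eval (f T) x := rfl

theorem continuous_reindex (f : Family n → Family n) : Continuous (reindex f) :=
  AddMonoidHomClass.continuous_of_bound _ 1 fun x => by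
    simpa using NonUnitalStarAlgHom.norm_apply_le (reindex f) x

end Product

/-- The C*-subalgebra of the product generated by the universal isometries. -/
def generated (n : ℕ) : StarSubalgebra ℂ (Product n) :=
  (StarAlgebra.adjoin ℂ (Set.range (Product.gen (n := n)))).topologicalClosure

/-- The Cuntz algebra `𝒪_n`. -/
abbrev CuntzAlgebra (n : ℕ) : Type := generated n

instance (n : ℕ) : CStarAlgebra (CuntzAlgebra n) :=
  StarSubalgebra.cstarAlgebra (generated n)
    (h_closed := StarSubalgebra.isClosed_topologicalClosure _)

/-- The inclusion of the Cuntz algebra into the product. -/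
def incl (n : ℕ) : CuntzAlgebra n →⋆ₐ[ℂ] Product n := (generated n).subtype

theorem incl_mem {n : ℕ} (x : CuntzAlgebra n) : incl n x ∈ generated n := x.2

theorem incl_injective (n : ℕ) : Function.Injective (incl n) := Subtype.val_injective

variable {n : ℕ}

theorem gen_mem (i : Fin n) : Product.gen i ∈ generated n :=
  StarSubalgebra.le_topologicalClosure _ (StarAlgebra.subset_adjoin ℂ _ ⟨i, rfl⟩)

/-- The generating isometries `S_i` of `𝒪_n`. -/
def S (i : Fin n) : CuntzAlgebra n := ⟨Product.gen i, gen_mem i⟩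

@[simp]
theorem incl_S (i : Fin n) : incl n (S i) = Product.gen i := rfl

theorem star_S_mul_S (i : Fin n) : star (S i) * S i = 1 :=
  incl_injective n <| Product.ext fun T => by
    simpa [map_star, Product.gen] using T.isometry i

theorem sum_S_mul_star_S (n : ℕ) : ∑ i : Fin n, S i * star (S i) = 1 :=
  incl_injective n <| Product.ext fun T => by
    simpa [map_star, Product.gen] using T.sum_range

theorem star_S_mul_S_of_ne {i j : Fin n} (h : i ≠ j) : star (S i) * S j = 0 := by
  let _ := CStarAlgebra.spectralOrder (CuntzAlgebra n)
  let _ := CStarAlgebra.spectralOrderedRing (CuntzAlgebra n)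
  have key : ∑ k ∈ Finset.univ.erase j, star (star (S k) * S j) * (star (S k) * S j) = 0 := by
    have h1 : ∑ k : Fin n, star (star (S k) * S j) * (star (S k) * S j) = 1 := by
      calc ∑ k : Fin n, star (star (S k) * S j) * (star (S k) * S j)
          = star (S j) * (∑ k : Fin n, S k * star (S k)) * S j := by
            simp only [Finset.mul_sum, Finset.sum_mul, star_mul, star_star, mul_assoc]
        _ = 1 := by rw [sum_S_mul_star_S, mul_one, star_S_mul_S]
    rw [← Finset.add_sum_erase _ _ (Finset.mem_univ j), star_S_mul_S] at h1
    simpa using h1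
  rw [Finset.sum_eq_zero_iff_of_nonneg fun k _ => star_mul_self_nonneg _] at key
  exact CStarRing.star_mul_self_eq_zero_iff _ |>.1 (key i (by simp [h]))

/-! ### The endomorphisms `λ_u` -/

/-- For a unitary `u` of `𝒪_n`, the Cuntz family `(u S_i)_i`, evaluated at a Cuntz family. -/
def twist (u : unitary (CuntzAlgebra n)) (T : Family n) : Family n where
  op i := Product.eval T (incl n u) * T.op i
  isometry i := by
    have hu : star (Product.eval T (incl n u)) * Product.eval T (incl n u) = 1 := by
      rw [← map_star, ← map_star, ← map_mul, ← map_mul, Unitary.coe_star_mul_self, map_one,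
        map_one]
    rw [star_mul, mul_assoc, ← mul_assoc (star (Product.eval T (incl n u))), hu, one_mul,
      T.isometry]
  sum_range := by
    have hu : Product.eval T (incl n u) * star (Product.eval T (incl n u)) = 1 := by
      rw [← map_star, ← map_star, ← map_mul, ← map_mul, Unitary.mul_star_self_of_mem u.2, map_one,
        map_one]
    have h (i : Fin n) : Product.eval T (incl n u) * T.op i *
        star (Product.eval T (incl n u) * T.op i) =
        Product.eval T (incl n u) * (T.op i * star (T.op i)) *
          star (Product.eval T (incl n u)) := by
      simp only [star_mul, mul_assoc]
    simp only [h]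
    rw [← Finset.sum_mul, ← Finset.mul_sum, T.sum_range, mul_one, hu]

theorem reindex_twist_gen (u : unitary (CuntzAlgebra n)) (i : Fin n) :
    Product.reindex (twist u) (Product.gen i) = incl n (u * S i) :=
  Product.ext fun T => by rw [map_mul, map_mul]; rfl

theorem reindex_twist_gen_mem (u : unitary (CuntzAlgebra n)) (i : Fin n) :
    Product.reindex (twist u) (Product.gen i) ∈ generated n := by
  rw [reindex_twist_gen]
  exact incl_mem _

theorem isClosed_generated (n : ℕ) : IsClosed (generated n : Set (Product n)) :=
  StarSubalgebra.isClosed_topologicalClosure _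

theorem generated_le {A : StarSubalgebra ℂ (Product n)} (hA : IsClosed (A : Set (Product n)))
    (h : ∀ i, Product.gen i ∈ A) : generated n ≤ A :=
  StarSubalgebra.topologicalClosure_minimal
    (StarAlgebra.adjoin_le (by rintro _ ⟨i, rfl⟩; exact h i)) hA

theorem isClosed_comap (f : Family n → Family n) :
    IsClosed ((generated n).comap (Product.reindex f) : Set (Product n)) := by
  rw [StarSubalgebra.coe_comap]
  exact (isClosed_generated n).preimage (Product.continuous_reindex f)

theorem reindex_twist_mem (u : unitary (CuntzAlgebra n)) (x : CuntzAlgebra n) :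
    Product.reindex (twist u) (incl n x) ∈ generated n := by
  have h : generated n ≤ (generated n).comap (Product.reindex (twist u)) :=
    generated_le (isClosed_comap _) fun i =>
      (StarSubalgebra.mem_comap _ _ _).2 (reindex_twist_gen_mem u i)
  exact (StarSubalgebra.mem_comap _ _ _).1 (h (incl_mem x))

/-- The unital `*`-endomorphism `λ_u` of `𝒪_n` determined by `λ_u(S_i) = u S_i`. -/
def endo (u : unitary (CuntzAlgebra n)) : CuntzAlgebra n →⋆ₐ[ℂ] CuntzAlgebra n :=
  ((Product.reindex (twist u)).comp (incl n)).codRestrict (generated n) (reindex_twist_mem u)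

@[simp]
theorem endo_S (u : unitary (CuntzAlgebra n)) (i : Fin n) : endo u (S i) = u * S i :=
  incl_injective n (reindex_twist_gen u i)

/-! ### Words, the core `ℱ_n`, the diagonal `𝒟_n` and the canonical shift -/

/-- `S_μ = S_{μ_1} ⋯ S_{μ_k}` for a multi-index `μ`; the empty multi-index gives `1`. -/
def word (μ : List (Fin n)) : CuntzAlgebra n := (μ.map S).prod

/-- The range projection `P_μ = S_μ S_μ^*`. -/
def proj (μ : List (Fin n)) : CuntzAlgebra n := word μ * star (word μ)

/-- `ℱ_n^k`: the subalgebra generated (in fact, linearly spanned) by the words `S_μ S_ν^*`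
with `|μ| = |ν| = k`. -/
def coreLevel (n k : ℕ) : StarSubalgebra ℂ (CuntzAlgebra n) :=
  StarAlgebra.adjoin ℂ
    {x | ∃ μ ν : List (Fin n), μ.length = k ∧ ν.length = k ∧ x = word μ * star (word ν)}

/-- The core UHF-subalgebra `ℱ_n`: the norm closure of the increasing union of the `ℱ_n^k`. -/
def core (n : ℕ) : StarSubalgebra ℂ (CuntzAlgebra n) := (⨆ k, coreLevel n k).topologicalClosure

/-- The diagonal `𝒟_n`: the C*-subalgebra generated by all projections `P_μ`. -/
def diag (n : ℕ) : StarSubalgebra ℂ (CuntzAlgebra n) :=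
  (StarAlgebra.adjoin ℂ (Set.range (proj (n := n)))).topologicalClosure

/-- `𝒟_n^k = 𝒟_n ∩ ℱ_n^k`. -/
def diagLevel (n k : ℕ) : StarSubalgebra ℂ (CuntzAlgebra n) := diag n ⊓ coreLevel n k

theorem diag_le_core (n : ℕ) : diag n ≤ core n := by
  refine StarSubalgebra.topologicalClosure_mono (StarAlgebra.adjoin_le ?_)
  rintro _ ⟨μ, rfl⟩
  exact (le_iSup (coreLevel n) μ.length)
    (StarAlgebra.subset_adjoin ℂ _ ⟨μ, μ, rfl, rfl, rfl⟩)

/-- The inclusion `𝒟_n ⊆ ℱ_n`. -/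
def diagToCore (n : ℕ) : diag n →⋆ₐ[ℂ] core n := StarSubalgebra.inclusion (diag_le_core n)

/-- The canonical shift `φ(x) = ∑ S_i x S_i^*` of `𝒪_n`. -/
def shift (n : ℕ) : CuntzAlgebra n →⋆ₐ[ℂ] CuntzAlgebra n where
  toFun x := ∑ i, S i * x * star (S i)
  map_one' := by simpa using sum_S_mul_star_S n
  map_mul' x y := by
    rw [Finset.sum_mul_sum]
    refine Finset.sum_congr rfl fun i _ => ?_
    rw [Finset.sum_eq_single i]
    · simp only [mul_assoc]
      rw [← mul_assoc (star (S i)) (S i), star_S_mul_S, one_mul]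
    · intro j _ hj
      simp only [mul_assoc]
      rw [← mul_assoc (star (S i)) (S j), star_S_mul_S_of_ne hj.symm]
      simp
    · simp
  map_zero' := by simp
  map_add' x y := by simp [mul_add, add_mul, Finset.sum_add_distrib]
  commutes' r := by
    simp only [Algebra.algebraMap_eq_smul_one, mul_smul_comm, smul_mul_assoc, mul_one,
      ← Finset.smul_sum, sum_S_mul_star_S]
  map_star' x := by simp [star_sum, mul_assoc]

theorem shift_apply (x : CuntzAlgebra n) : shift n x = ∑ i, S i * x * star (S i) := rfl

theorem shift_mem_diag (x : diag n) : shift n x ∈ diag n := by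
  have hc : Continuous (shift n) :=
    AddMonoidHomClass.continuous_of_bound _ 1 fun x => by
      simpa using NonUnitalStarAlgHom.norm_apply_le (shift n) x
  have h : diag n ≤ (diag n).comap (shift n) := by
    refine StarSubalgebra.topologicalClosure_minimal (StarAlgebra.adjoin_le ?_) ?_
    · rintro _ ⟨μ, rfl⟩
      change shift n (proj μ) ∈ diag n
      rw [shift_apply]
      refine sum_mem fun i _ => ?_
      have hi : S i * proj μ * star (S i) = proj (i :: μ) := by
        simp [proj, word, mul_assoc]
      rw [hi]
      exact StarSubalgebra.le_topologicalClosure _ (StarAlgebra.subset_adjoin ℂ _ ⟨_, rfl⟩)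
    · exact (StarSubalgebra.isClosed_topologicalClosure _).preimage hc
  exact h x.2

/-- The restriction of the canonical shift to `𝒟_n`. -/
def diagShift (n : ℕ) : diag n →⋆ₐ[ℂ] diag n :=
  ((shift n).comp (diag n).subtype).codRestrict (diag n) shift_mem_diag

/-- Property (P) of an automorphism `α` of `𝒟_n`: there is `m` such that
`α φ^k(x) = φ^{k-m} α φ^m(x)` for all `k ≥ m` and all `x ∈ 𝒟_n^1`. -/
def PropertyP (α : diag n ≃⋆ₐ[ℂ] diag n) : Prop :=
  ∃ m : ℕ, ∀ k ≥ m, ∀ x : diag n, (x : CuntzAlgebra n) ∈ diagLevel n 1 →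
    α ((diagShift n)^[k] x) = (diagShift n)^[k - m] (α ((diagShift n)^[m] x))

/-- `𝒮_n`: the unitaries of `𝒪_n` which are finite sums of words `S_μ S_ν^*`. -/
def wordUnitaries (n : ℕ) : Set (unitary (CuntzAlgebra n)) :=
  {u | ∃ (m : ℕ) (μ ν : Fin m → List (Fin n)),
    (u : CuntzAlgebra n) = ∑ j, word (μ j) * star (word (ν j))}

/-- The permutation unitaries `𝒫_n = 𝒮_n ∩ 𝒰(ℱ_n)`. -/
def permUnitaries (n : ℕ) : Set (unitary (CuntzAlgebra n)) :=
  {u | u ∈ wordUnitaries n ∧ (u : CuntzAlgebra n) ∈ core n}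

/-- A normalized trace (tracial state) on `ℱ_n`. -/
structure IsNormalizedTrace (τ : core n →ₗ[ℂ] ℂ) : Prop where
  map_one : τ 1 = 1
  nonneg : ∀ x, 0 ≤ τ (star x * x)
  map_mul_comm : ∀ x y, τ (x * y) = τ (y * x)

end Cuntz

end

/-!
Write `φ` for the shift and `β = α⁻¹`; a map on `𝒟_n` is tested on the projections `P_μ`.

If `α = λ_u` on `𝒟_n` with `u` a permutation unitary, then averaging `u` over finitely many gauge
automorphisms shows `u ∈ ℱ_n^k` for some `k` (`exists_mem_coreLevel_of_eq_sum`). Since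
`λ_u φ = Ad(u) φ λ_u` and `ℱ_n^k` commutes with the range of `φ^k`, applying `α` to both sides
gives `β φ^{l+1} = φ β φ^l` for `l ≥ k`, which is property (P) (`propertyP_symm_of_eq_endo`).

Conversely, `α` is the restriction of `λ_u` as soon as `α(S_i β(y) S_i^*) = u S_i y S_i^* u^*` for
all `y ∈ 𝒟_n`, so `u` has to implement the endomorphism `θ` of `𝒟_n` that sends `S_i y S_i^*` to
`α(S_i β(y) S_i^*)`. Property (P) of `β` with constant `m` says exactly that `α φ β = φ` on the
range of `φ^m` (`exists_shiftConj_iterate`), hence that `θ` fixes the range of `φ^{m+1}`. The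
finitely many projections `θ(P_κ)`, `|κ| = m + 1`, lie in a common finite level
(`exists_mul_proj_eq_zero_or`), so for some `k ≥ m + 1` the map `θ` sends `P_ν`, `|ν| = k`, to sums
of such projections (`exists_cyl_mul_dproj`); by counting it permutes them
(`exists_perm_cyl_eq_dproj`). The corresponding permutation unitary is the required `u`
(`exists_permUnitary_of_propertyP`).

A trace on `ℱ_n` is obtained as an ultrafilter limit of `x ↦ n^{-k} ∑_{|μ| = k} ψ(S_μ^* x S_μ)` for
a vector state `ψ`: the limit is a state of `𝒪_n` with `ℱ_n` in its centralizer
(`exists_state_centralizing_core`). The matrix units determine a trace on every `ℱ_n^k`, and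
positive functionals are continuous, so the trace is unique (`IsNormalizedTrace.eq`). Since `λ_u`
maps `ℱ_n` into itself for `u ∈ ℱ_n`, it extends `α` to `ℱ_n`, and the pull-back of the trace along
`λ_u` is again a normalized trace; uniqueness shows that `λ_u`, and so `α` and `α⁻¹`, preserve it.
-/

noncomputable section

namespace Cuntz

variable {n : ℕ}

/-! ### Words of generators and iterates of the shift -/

@[simp]
theorem word_nil : word ([] : List (Fin n)) = 1 := rfl

theorem word_cons (i : Fin n) (μ : List (Fin n)) : word (i :: μ) = S i * word μ := by
  simp [word]

theorem word_append (μ ν : List (Fin n)) : word (μ ++ ν) = word μ * word ν := by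
  simp [word]

theorem star_S_mul_S_ite (i j : Fin n) :
    star (S i) * S j = if i = j then (1 : CuntzAlgebra n) else 0 := by
  split_ifs with h
  · rw [h, star_S_mul_S]
  · exact star_S_mul_S_of_ne h

theorem star_word_mul_word {μ ν : List (Fin n)} (h : μ.length = ν.length) :
    star (word μ) * word ν = if μ = ν then 1 else 0 := by
  induction μ generalizing ν with
  | nil =>
    obtain rfl : ν = [] := List.length_eq_zero_iff.1 h.symm
    simp
  | cons i μ ih =>
    cases ν with
    | nil => simp at h
    | cons j ν =>
      rw [word_cons, word_cons, star_mul, mul_assoc, ← mul_assoc (star (S i)), star_S_mul_S_ite]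
      by_cases hij : i = j
      · simp [hij, ih (Nat.succ.inj h)]
      · simp [hij]

theorem star_word_mul_self (μ : List (Fin n)) : star (word μ) * word μ = 1 := by
  rw [star_word_mul_word rfl, if_pos rfl]

/-- `S_μ` for a multi-index `μ` of a fixed length `k`. Indexing by `Fin k → Fin n` makes the
multi-indices of length `k` a finite type to sum over. -/
def fword {k : ℕ} (μ : Fin k → Fin n) : CuntzAlgebra n := word (List.ofFn μ)

theorem exists_ofFn_eq {μ : List (Fin n)} {k : ℕ} (h : μ.length = k) :
    ∃ μ' : Fin k → Fin n, List.ofFn μ' = μ := by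
  subst h
  exact ⟨μ.get, List.ofFn_get μ⟩

theorem star_fword_mul_fword {k : ℕ} (μ ν : Fin k → Fin n) :
    star (fword μ) * fword ν = if μ = ν then (1 : CuntzAlgebra n) else 0 := by
  rw [fword, fword, star_word_mul_word (by simp)]
  simp [List.ofFn_inj]

theorem fword_cons {k : ℕ} (i : Fin n) (μ : Fin k → Fin n) :
    fword (Fin.cons i μ : Fin (k + 1) → Fin n) = S i * fword μ := by
  rw [fword, fword, List.ofFn_cons, word_cons]

theorem sum_fun_succ {M : Type*} [AddCommMonoid M] {k : ℕ} (f : (Fin (k + 1) → Fin n) → M) :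
    ∑ μ, f μ = ∑ i, ∑ μ : Fin k → Fin n, f (Fin.cons i μ) := by
  rw [← (Fin.consEquiv fun _ => Fin n).sum_comp, Fintype.sum_prod_type]
  rfl

theorem iterate_shift_eq_sum (k : ℕ) (x : CuntzAlgebra n) :
    (shift n)^[k] x = ∑ μ : Fin k → Fin n, fword μ * x * star (fword μ) := by
  induction k with
  | zero => simp [fword]
  | succ k ih =>
    rw [Function.iterate_succ_apply', ih, shift_apply, sum_fun_succ]
    simp only [fword_cons, star_mul, Finset.mul_sum, Finset.sum_mul, mul_assoc]

theorem sum_fword_mul_star (n k : ℕ) :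
    ∑ μ : Fin k → Fin n, fword μ * star (fword μ) = 1 := by
  simpa [iterate_map_one] using (iterate_shift_eq_sum k (1 : CuntzAlgebra n)).symm

theorem iterate_shift_mul_fword {k : ℕ} (μ : Fin k → Fin n) (x : CuntzAlgebra n) :
    (shift n)^[k] x * fword μ = fword μ * x := by
  rw [iterate_shift_eq_sum, Finset.sum_mul, Finset.sum_eq_single μ]
  · rw [mul_assoc, star_fword_mul_fword, if_pos rfl, mul_one]
  · intro ν _ h
    rw [mul_assoc, star_fword_mul_fword, if_neg h, mul_zero]
  · simp

theorem star_fword_mul_iterate_shift {k : ℕ} (μ : Fin k → Fin n) (x : CuntzAlgebra n) :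
    star (fword μ) * (shift n)^[k] x = x * star (fword μ) := by
  rw [iterate_shift_eq_sum, Finset.mul_sum, Finset.sum_eq_single μ]
  · rw [← mul_assoc, ← mul_assoc, star_fword_mul_fword, if_pos rfl, one_mul]
  · intro ν _ h
    rw [← mul_assoc, ← mul_assoc, star_fword_mul_fword, if_neg h.symm, zero_mul, zero_mul]
  · simp

theorem star_iterate_shift (k : ℕ) (x : CuntzAlgebra n) :
    star ((shift n)^[k] x) = (shift n)^[k] (star x) := by
  induction k with
  | zero => rfl
  | succ k ih => rw [Function.iterate_succ_apply', Function.iterate_succ_apply', ← map_star, ih]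

/-! ### The levels of the core -/

theorem fword_mul_star_mem_coreLevel {k : ℕ} (μ ν : Fin k → Fin n) :
    fword μ * star (fword ν) ∈ coreLevel n k :=
  StarAlgebra.subset_adjoin ℂ _ ⟨_, _, by simp, by simp, rfl⟩

theorem coreLevel_le {k : ℕ} {A : StarSubalgebra ℂ (CuntzAlgebra n)}
    (h : ∀ μ ν : Fin k → Fin n, fword μ * star (fword ν) ∈ A) : coreLevel n k ≤ A := by
  refine StarAlgebra.adjoin_le ?_
  rintro _ ⟨μ, ν, hμ, hν, rfl⟩
  obtain ⟨μ, rfl⟩ := exists_ofFn_eq hμ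
  obtain ⟨ν, rfl⟩ := exists_ofFn_eq hν
  exact h μ ν

theorem coreLevel_le_core (k : ℕ) : coreLevel n k ≤ core n :=
  (le_iSup (coreLevel n) k).trans (StarSubalgebra.le_topologicalClosure _)

theorem core_le {A : StarSubalgebra ℂ (CuntzAlgebra n)} (hA : IsClosed (A : Set (CuntzAlgebra n)))
    (h : ∀ (k : ℕ) (μ ν : Fin k → Fin n), fword μ * star (fword ν) ∈ A) : core n ≤ A :=
  StarSubalgebra.topologicalClosure_minimal (iSup_le fun k => coreLevel_le (h k)) hA

theorem word_mul_star_mem_coreLevel {μ ν : List (Fin n)} (h : μ.length = ν.length) {k : ℕ}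
    (hk : μ.length ≤ k) : word μ * star (word ν) ∈ coreLevel n k := by
  obtain ⟨l, rfl⟩ := Nat.exists_eq_add_of_le hk
  have : word μ * star (word ν) = ∑ κ : Fin l → Fin n,
      word (μ ++ List.ofFn κ) * star (word (ν ++ List.ofFn κ)) := by
    simp only [word_append, star_mul, mul_assoc]
    simp only [← mul_assoc (word (List.ofFn _)), ← Finset.mul_sum, ← Finset.sum_mul]
    rw [show ∑ κ : Fin l → Fin n, word (List.ofFn κ) * star (word (List.ofFn κ)) = 1 from
      sum_fword_mul_star n l, one_mul]
  rw [this]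
  exact sum_mem fun κ _ => StarAlgebra.subset_adjoin ℂ _
    ⟨_, _, by simp, by simp [h], rfl⟩

theorem coreLevel_mono : Monotone (coreLevel n) := fun k l hkl =>
  coreLevel_le fun μ ν => word_mul_star_mem_coreLevel (by simp) (by simpa using hkl)

/-- `ℱ_n^k` commutes with the range of `φ^k`. -/
theorem iterate_shift_comm {k : ℕ} {x : CuntzAlgebra n} (hx : x ∈ coreLevel n k)
    (y : CuntzAlgebra n) : (shift n)^[k] y * x = x * (shift n)^[k] y := by
  have h : coreLevel n k ≤ StarSubalgebra.centralizer ℂ (Set.range (shift n)^[k]) := by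
    refine coreLevel_le fun μ ν => StarSubalgebra.mem_centralizer_iff ℂ |>.2 ?_
    rintro _ ⟨y, rfl⟩
    have key (y : CuntzAlgebra n) : (shift n)^[k] y * (fword μ * star (fword ν)) =
        fword μ * star (fword ν) * (shift n)^[k] y := by
      rw [← mul_assoc, iterate_shift_mul_fword, mul_assoc, mul_assoc,
        star_fword_mul_iterate_shift]
    refine ⟨key y, ?_⟩
    rw [star_iterate_shift]
    exact key _
  exact (StarSubalgebra.mem_centralizer_iff ℂ |>.1 (h hx) _ ⟨y, rfl⟩).1

/-- `S_μ^* x S_ν` is a scalar for `x ∈ ℱ_n^k` and `|μ| = |ν| = k`: these scalars are the matrix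
entries of `x` under `ℱ_n^k ≅ M_{n^k}(ℂ)`. -/
theorem exists_smul_one_of_mem_coreLevel {k : ℕ} {x : CuntzAlgebra n} (hx : x ∈ coreLevel n k)
    (μ ν : Fin k → Fin n) : ∃ c : ℂ, star (fword μ) * x * fword ν = c • 1 := by
  refine StarAlgebra.adjoin_induction (p := fun x _ => ∀ μ ν : Fin k → Fin n, ∃ c : ℂ,
    star (fword μ) * x * fword ν = c • 1) ?_ ?_ ?_ ?_ ?_ hx μ ν
  · rintro _ ⟨κ, ρ, hκ, hρ, rfl⟩ μ ν
    obtain ⟨κ, rfl⟩ := exists_ofFn_eq hκ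
    obtain ⟨ρ, rfl⟩ := exists_ofFn_eq hρ
    change ∃ c : ℂ, star (fword μ) * (fword κ * star (fword ρ)) * fword ν = c • 1
    rw [← mul_assoc, mul_assoc, star_fword_mul_fword, star_fword_mul_fword]
    exact ⟨(if μ = κ then 1 else 0) * (if ρ = ν then 1 else 0), by split_ifs <;> simp⟩
  · intro r μ ν
    rw [Algebra.algebraMap_eq_smul_one, mul_smul_comm, mul_one, smul_mul_assoc,
      star_fword_mul_fword]
    exact ⟨r * (if μ = ν then 1 else 0), by split_ifs <;> simp⟩
  · intro x y _ _ hx hy μ ν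
    obtain ⟨c, hc⟩ := hx μ ν
    obtain ⟨d, hd⟩ := hy μ ν
    exact ⟨c + d, by rw [mul_add, add_mul, hc, hd, add_smul]⟩
  · intro x y _ _ hx hy μ ν
    choose c hc using hx
    choose d hd using hy
    refine ⟨∑ κ, c μ κ * d κ ν, ?_⟩
    calc star (fword μ) * (x * y) * fword ν
        = star (fword μ) * x * (∑ κ : Fin k → Fin n, fword κ * star (fword κ)) *
            (y * fword ν) := by rw [sum_fword_mul_star]; simp only [mul_assoc, one_mul]
      _ = ∑ κ : Fin k → Fin n, (star (fword μ) * x * fword κ) *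
            (star (fword κ) * y * fword ν) := by
          simp only [Finset.mul_sum, Finset.sum_mul, mul_assoc]
      _ = _ := by simp [hc, hd, Finset.sum_smul, smul_smul, mul_comm]
  · intro x _ hx μ ν
    obtain ⟨c, hc⟩ := hx ν μ
    refine ⟨star c, ?_⟩
    have := congrArg star hc
    simpa [mul_assoc] using this

theorem eq_sum_of_mem_coreLevel {k : ℕ} {x : CuntzAlgebra n} (hx : x ∈ coreLevel n k) :
    ∃ c : (Fin k → Fin n) → (Fin k → Fin n) → ℂ,
      x = ∑ μ, ∑ ν, c μ ν • (fword μ * star (fword ν)) := by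
  choose c hc using exists_smul_one_of_mem_coreLevel hx
  refine ⟨c, ?_⟩
  calc x = (∑ μ : Fin k → Fin n, fword μ * star (fword μ)) * x *
        ∑ μ : Fin k → Fin n, fword μ * star (fword μ) := by
        rw [sum_fword_mul_star, one_mul, mul_one]
    _ = ∑ μ : Fin k → Fin n, ∑ ν : Fin k → Fin n,
          fword μ * (star (fword μ) * x * fword ν) * star (fword ν) := by
        simp only [Finset.mul_sum, Finset.sum_mul, mul_assoc]
        rw [Finset.sum_comm]
    _ = _ := by simp [hc]

/-- The union of the levels `ℱ_n^k` is already a `*`-subalgebra, and it is dense in `ℱ_n`. -/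
theorem core_eq_closure_iUnion (n : ℕ) :
    (core n : Set (CuntzAlgebra n)) = closure (⋃ k, (coreLevel n k : Set (CuntzAlgebra n))) := by
  rw [core, StarSubalgebra.topologicalClosure_coe,
    StarSubalgebra.coe_iSup_of_directed coreLevel_mono.directed_le]

theorem isClosed_core (n : ℕ) : IsClosed (core n : Set (CuntzAlgebra n)) :=
  StarSubalgebra.isClosed_topologicalClosure _

/-! ### Endomorphisms of the form `λ_u` with `u ∈ ℱ_n` -/

theorem S_mul_mul_star_S_mem_core {x : CuntzAlgebra n} (hx : x ∈ core n) (i j : Fin n) :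
    S i * x * star (S j) ∈ core n := by
  rw [← SetLike.mem_coe, core_eq_closure_iUnion] at hx
  refine (isClosed_core n).closure_subset (map_mem_closure (f := fun x => S i * x * star (S j))
    (by fun_prop) hx ?_)
  intro y hy
  obtain ⟨k, hk⟩ := Set.mem_iUnion.1 hy
  obtain ⟨c, rfl⟩ := eq_sum_of_mem_coreLevel hk
  simp only [Finset.mul_sum, Finset.sum_mul, mul_smul_comm, smul_mul_assoc]
  refine sum_mem fun μ _ => sum_mem fun ν _ => (core n).smul_mem ?_ _
  have := coreLevel_le_core (k + 1) (fword_mul_star_mem_coreLevel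
    (Fin.cons i μ : Fin (k + 1) → Fin n) (Fin.cons j ν : Fin (k + 1) → Fin n))
  simpa only [fword_cons, star_mul, mul_assoc] using this

theorem endo_word_cons (u : unitary (CuntzAlgebra n)) (i : Fin n) (μ : List (Fin n)) :
    endo u (word (i :: μ)) = u * S i * endo u (word μ) := by
  rw [word_cons, map_mul, endo_S]

theorem continuous_endo (u : unitary (CuntzAlgebra n)) : Continuous (endo u) :=
  AddMonoidHomClass.continuous_of_bound _ 1 fun x => by
    simpa using NonUnitalStarAlgHom.norm_apply_le (endo u) x

theorem isClosed_comap_endo (u : unitary (CuntzAlgebra n)) {A : StarSubalgebra ℂ (CuntzAlgebra n)}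
    (hA : IsClosed (A : Set (CuntzAlgebra n))) :
    IsClosed (A.comap (endo u) : Set (CuntzAlgebra n)) := by
  rw [StarSubalgebra.coe_comap]
  exact hA.preimage (continuous_endo u)

theorem endo_fword_mul_star_mem_core {u : unitary (CuntzAlgebra n)}
    (hu : (u : CuntzAlgebra n) ∈ core n) {k : ℕ} (μ ν : Fin k → Fin n) :
    endo u (fword μ * star (fword ν)) ∈ core n := by
  induction k with
  | zero => simp [fword]
  | succ k ih =>
    obtain ⟨i, μ, rfl⟩ : ∃ i μ', μ = Fin.cons i μ' := ⟨_, _, (Fin.cons_self_tail μ).symm⟩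
    obtain ⟨j, ν, rfl⟩ : ∃ i μ', ν = Fin.cons i μ' := ⟨_, _, (Fin.cons_self_tail ν).symm⟩
    have := mul_mem (mul_mem hu (S_mul_mul_star_S_mem_core (ih μ ν) i j)) (star_mem hu)
    simpa only [fword_cons, map_mul, star_mul, map_star, endo_S, mul_assoc] using this

theorem endo_mem_core {u : unitary (CuntzAlgebra n)} (hu : (u : CuntzAlgebra n) ∈ core n)
    {x : CuntzAlgebra n} (hx : x ∈ core n) : endo u x ∈ core n := by
  have h : core n ≤ (core n).comap (endo u) :=
    core_le (isClosed_comap_endo u (isClosed_core n)) fun k μ ν =>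
      (StarSubalgebra.mem_comap _ _ _).2 (endo_fword_mul_star_mem_core hu μ ν)
  exact (StarSubalgebra.mem_comap _ _ _).1 (h hx)

/-- `λ_u φ = Ad(u) φ λ_u`. -/
theorem endo_shift (u : unitary (CuntzAlgebra n)) (x : CuntzAlgebra n) :
    endo u (shift n x) = u * shift n (endo u x) * star (u : CuntzAlgebra n) := by
  simp only [shift_apply, map_sum, map_mul, map_star, endo_S, star_mul, Finset.mul_sum,
    Finset.sum_mul, mul_assoc]

/-! ### The gauge action and permutation unitaries -/

/-- The scalar unitary `z • 1` for `|z| = 1`. The gauge automorphism at `z` is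
`endo (scalarUnitary z hz)`. -/
def scalarUnitary (z : ℂ) (hz : star z * z = 1) : unitary (CuntzAlgebra n) :=
  ⟨z • 1, by
    have hz' : z * star z = 1 := by rw [mul_comm, hz]
    rw [Unitary.mem_iff, star_smul, star_one, smul_mul_smul_comm, smul_mul_smul_comm, hz, hz',
      one_mul, one_smul]
    exact ⟨rfl, rfl⟩⟩

theorem coe_scalarUnitary (z : ℂ) (hz : star z * z = 1) :
    ((scalarUnitary z hz : unitary (CuntzAlgebra n)) : CuntzAlgebra n) = z • 1 := rfl

theorem endo_scalarUnitary_word (z : ℂ) (hz : star z * z = 1) (μ : List (Fin n)) :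
    endo (scalarUnitary z hz) (word μ) = z ^ μ.length • word μ := by
  induction μ with
  | nil => simp
  | cons i μ ih =>
    rw [endo_word_cons, ih, word_cons, coe_scalarUnitary, smul_mul_assoc, one_mul,
      smul_mul_assoc, mul_smul_comm, smul_smul, List.length_cons, pow_succ']

theorem endo_scalarUnitary_word_mul_star (z : ℂ) (hz : star z * z = 1) (μ ν : List (Fin n)) :
    endo (scalarUnitary z hz) (word μ * star (word ν)) =
      (z ^ μ.length * star z ^ ν.length) • (word μ * star (word ν)) := by
  rw [map_mul, map_star, endo_scalarUnitary_word, endo_scalarUnitary_word, star_smul,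
    smul_mul_smul_comm, star_pow]

/-- The gauge automorphisms fix the core. -/
theorem endo_scalarUnitary_eq_self (z : ℂ) (hz : star z * z = 1) {x : CuntzAlgebra n}
    (hx : x ∈ core n) : endo (scalarUnitary z hz) x = x := by
  have hcl : IsClosed (StarAlgHom.equalizer (endo (scalarUnitary z hz))
      (StarAlgHom.id ℂ (CuntzAlgebra n)) : Set (CuntzAlgebra n)) :=
    isClosed_eq (continuous_endo _) continuous_id
  refine (StarAlgHom.mem_equalizer _ _ _).1 (core_le hcl (fun k μ ν => ?_) hx)
  rw [StarAlgHom.mem_equalizer, fword, fword, endo_scalarUnitary_word_mul_star, List.length_ofFn,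
    List.length_ofFn, ← mul_pow, mul_comm z, hz, one_pow, one_smul]
  rfl

/-- A finite sum of words `S_μ S_ν^*` that lies in the core lies in some `ℱ_n^k`: averaging over
the gauge automorphisms at the `N`-th roots of unity, for large `N`, fixes it and kills the words
with `|μ| ≠ |ν|`. -/
theorem exists_mem_coreLevel_of_eq_sum {m : ℕ} (μ ν : Fin m → List (Fin n)) {x : CuntzAlgebra n}
    (hx : x = ∑ j, word (μ j) * star (word (ν j))) (hcore : x ∈ core n) :
    ∃ k, x ∈ coreLevel n k := by
  -- `N` exceeds all lengths, so lengths that are congruent modulo `N` are equal.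
  obtain ⟨N, hN⟩ : ∃ N, ∀ j, (μ j).length < N ∧ (ν j).length < N := by
    refine ⟨∑ j, ((μ j).length + (ν j).length) + 1, fun j => ?_⟩
    have := Finset.single_le_sum (f := fun j => (μ j).length + (ν j).length)
      (fun _ _ => Nat.zero_le _) (Finset.mem_univ j)
    omega
  rcases Nat.eq_zero_or_pos m with rfl | hm
  · exact ⟨0, by simp [hx]⟩
  have hN0 : N ≠ 0 := by
    have := (hN ⟨0, hm⟩).1
    omega
  let ζ : ℂ := Complex.exp (2 * Real.pi * Complex.I / N)
  have hζ : IsPrimitiveRoot ζ N := Complex.isPrimitiveRoot_exp N hN0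
  have hs : star ζ * ζ = 1 := by
    have h1 : ‖ζ‖ = 1 := hζ.norm'_eq_one hN0
    rw [mul_comm]
    change ζ * (starRingEnd ℂ) ζ = 1
    rw [Complex.mul_conj, Complex.normSq_eq_norm_sq, h1]
    simp
  have hst (t : ℕ) : star (ζ ^ t) * ζ ^ t = 1 := by rw [star_pow, ← mul_pow, hs, one_pow]
  have hsum (j : Fin m) : ∑ t ∈ Finset.range N,
      (ζ ^ t) ^ (μ j).length * star (ζ ^ t) ^ (ν j).length =
        if (μ j).length = (ν j).length then (N : ℂ) else 0 := by
    split_ifs with h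
    · simp_rw [h, ← mul_pow, mul_comm (ζ ^ _) (star _), hst]
      simp
    · set r : ℂ := ζ ^ (μ j).length * star ζ ^ (ν j).length with hr
      have hr1 : r ≠ 1 := by
        intro h1
        refine h (hζ.pow_inj (hN j).1 (hN j).2 ?_)
        calc ζ ^ (μ j).length = ζ ^ (μ j).length * (star ζ * ζ) ^ (ν j).length := by
              rw [hs, one_pow, mul_one]
          _ = r * ζ ^ (ν j).length := by rw [hr, mul_pow, mul_assoc]
          _ = _ := by rw [h1, one_mul]
      have hrN : r ^ N = 1 := by
        rw [hr, mul_pow, ← pow_mul, ← pow_mul, mul_comm, mul_comm _ N, mul_comm _ N, pow_mul,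
          pow_mul, ← star_pow, hζ.pow_eq_one]
        simp
      have := geom_sum_mul r N
      rw [hrN, sub_self] at this
      rw [← (mul_eq_zero.1 this).resolve_right (sub_ne_zero.2 hr1)]
      refine Finset.sum_congr rfl fun t _ => ?_
      rw [hr, star_pow, mul_pow, ← pow_mul, ← pow_mul, ← pow_mul, ← pow_mul, mul_comm t,
        mul_comm t]
  have key : (N : ℂ) • x = (N : ℂ) • ∑ j, if (μ j).length = (ν j).length then
      word (μ j) * star (word (ν j)) else 0 := by
    calc (N : ℂ) • x = ∑ t ∈ Finset.range N, endo (scalarUnitary (ζ ^ t) (hst t)) x := by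
          simp [endo_scalarUnitary_eq_self _ _ hcore, Nat.cast_smul_eq_nsmul]
      _ = ∑ j, ∑ t ∈ Finset.range N, ((ζ ^ t) ^ (μ j).length * star (ζ ^ t) ^ (ν j).length) •
            (word (μ j) * star (word (ν j))) := by
          rw [hx, Finset.sum_comm]
          simp only [map_sum, endo_scalarUnitary_word_mul_star]
      _ = _ := by
          rw [Finset.smul_sum]
          refine Finset.sum_congr rfl fun j _ => ?_
          rw [← Finset.sum_smul, hsum]
          split_ifs <;> simp
  refine ⟨N, ?_⟩
  rw [smul_right_injective _ (Nat.cast_ne_zero.2 hN0) key]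
  refine sum_mem fun j _ => ?_
  split_ifs with h
  · exact word_mul_star_mem_coreLevel h (hN j).1.le
  · exact zero_mem _

theorem exists_mem_coreLevel_of_mem_permUnitaries {u : unitary (CuntzAlgebra n)}
    (hu : u ∈ permUnitaries n) : ∃ k, (u : CuntzAlgebra n) ∈ coreLevel n k := by
  obtain ⟨⟨m, μ, ν, h⟩, hc⟩ := hu
  exact exists_mem_coreLevel_of_eq_sum μ ν h hc

/-! ### Permutation unitaries give property (P) -/

theorem coe_diagShift (x : diag n) : (diagShift n x : CuntzAlgebra n) = shift n x := rfl

theorem coe_iterate_diagShift (k : ℕ) (x : diag n) :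
    ((diagShift n)^[k] x : CuntzAlgebra n) = (shift n)^[k] x := by
  induction k with
  | zero => rfl
  | succ k ih => rw [Function.iterate_succ_apply', Function.iterate_succ_apply', coe_diagShift, ih]

/-- If `u ∈ ℱ_n^k`, then `α⁻¹ φ^{l+1} = φ α⁻¹ φ^l` for all `l ≥ k`. -/
theorem propertyP_symm_of_eq_endo {α : diag n ≃⋆ₐ[ℂ] diag n} {u : unitary (CuntzAlgebra n)}
    {k : ℕ} (hu : (u : CuntzAlgebra n) ∈ coreLevel n k)
    (h : ∀ x : diag n, (α x : CuntzAlgebra n) = endo u x) : PropertyP α.symm := by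
  have step (l : ℕ) (hl : k ≤ l) (x : diag n) :
      α.symm ((diagShift n)^[l + 1] x) = diagShift n (α.symm ((diagShift n)^[l] x)) := by
    -- After applying `α = λ_u` on both sides, `φ^{l+1}(x)` commutes with `u`.
    rw [StarAlgEquiv.symm_apply_eq, ← Subtype.val_inj, h, coe_diagShift, endo_shift, ← h,
      α.apply_symm_apply, coe_iterate_diagShift, coe_iterate_diagShift,
      ← Function.iterate_succ_apply' (shift n),
      ← iterate_shift_comm (coreLevel_mono (by omega) hu), mul_assoc,
      Unitary.mul_star_self_of_mem u.2, mul_one]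
  refine ⟨k, fun l hl x _ => ?_⟩
  obtain ⟨j, rfl⟩ := Nat.exists_eq_add_of_le hl
  rw [Nat.add_sub_cancel_left]
  induction j with
  | zero => rfl
  | succ j ih =>
    rw [← Nat.add_assoc, step _ (by omega), ih (by omega), Function.iterate_succ_apply']

/-! ### The Cuntz algebra is nontrivial -/

/-- A bijection `Fin n × ℕ ≃ ℕ` yields a Cuntz family on `ℓ²(ℕ)`: the `i`-th isometry sends the
basis vector `e_k` to `e_{(i,k)}`. -/
theorem nonempty_family (hn : n ≠ 0) : Nonempty (Family n) := by
  have : NeZero n := ⟨hn⟩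
  obtain ⟨e⟩ : Nonempty (Fin n × ℕ ≃ ℕ) := nonempty_equiv_of_countable
  let b : HilbertBasis ℕ ℂ Hilb := ⟨LinearIsometryEquiv.refl ℂ _⟩
  have ho (i : Fin n) : Orthonormal ℂ fun k => b (e (i, k)) :=
    b.orthonormal.comp _ fun k l h => by simpa using h
  let T (i : Fin n) : Hilb →L[ℂ] Hilb :=
    (ho i).orthogonalFamily.linearIsometry.toContinuousLinearMap
  have hT (i : Fin n) (k : ℕ) : T i (b k) = b (e (i, k)) := by
    have hb : b k = lp.single 2 k (1 : ℂ) := (b.repr_symm_single k).symm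
    change (ho i).orthogonalFamily.linearIsometry (b k) = _
    rw [hb, OrthogonalFamily.linearIsometry_apply_single, LinearIsometry.toSpanSingleton_apply,
      one_smul]
  have hext {A B : Hilb →L[ℂ] Hilb} (h : ∀ k, A (b k) = B (b k)) : A = B :=
    ContinuousLinearMap.ext_on (Submodule.dense_iff_topologicalClosure_eq_top.2 b.dense_span)
      (by rintro _ ⟨k, rfl⟩; exact h k)
  have hst (i j : Fin n) (k : ℕ) : star (T i) (b (e (j, k))) = if i = j then b k else 0 := by
    refine b.repr.injective (lp.ext (funext fun l => ?_))
    rw [b.repr_apply_apply, b.repr_apply_apply, ContinuousLinearMap.star_eq_adjoint,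
      ContinuousLinearMap.adjoint_inner_right, hT,
      orthonormal_iff_ite.1 b.orthonormal]
    by_cases hij : i = j
    · simp [hij, orthonormal_iff_ite.1 b.orthonormal]
    · simp [hij]
  refine ⟨⟨T, fun i => hext fun k => ?_, hext fun l => ?_⟩⟩
  · simp [hT, hst]
  · obtain ⟨⟨j, k⟩, rfl⟩ := e.surjective l
    simp [hT, hst, sum_apply, apply_ite]

theorem nontrivial_cuntzAlgebra (hn : n ≠ 0) : Nontrivial (CuntzAlgebra n) := by
  obtain ⟨T⟩ := nonempty_family hn
  refine ⟨1, 0, fun h => ?_⟩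
  have := congrArg (fun x => Product.eval T (incl n x)) h
  simp at this

/-! ### The diagonal -/

theorem proj_mem_diag (μ : List (Fin n)) : proj μ ∈ diag n :=
  StarSubalgebra.le_topologicalClosure _ (StarAlgebra.subset_adjoin ℂ _ ⟨μ, rfl⟩)

theorem star_proj (μ : List (Fin n)) : star (proj μ) = proj μ := by
  simp [proj]

theorem proj_mul_proj {μ ν : List (Fin n)} (h : μ.length = ν.length) :
    proj μ * proj ν = if μ = ν then proj μ else 0 := by
  rw [proj, proj, mul_assoc, ← mul_assoc (star (word μ)), star_word_mul_word h]
  split_ifs with hμ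
  · simp [hμ]
  · simp

theorem isStarProjection_proj (μ : List (Fin n)) : IsStarProjection (proj μ) :=
  ⟨by rw [IsIdempotentElem, proj_mul_proj rfl, if_pos rfl], star_proj μ⟩

theorem proj_ne_zero (hn : n ≠ 0) (μ : List (Fin n)) : proj μ ≠ 0 := by
  have := nontrivial_cuntzAlgebra hn
  intro h
  have h1 : star (word μ) * proj μ * word μ = 1 := by
    rw [proj, ← mul_assoc, star_word_mul_self, one_mul, star_word_mul_self]
  rw [h] at h1
  simp at h1

/-- A cylinder projection is either contained in, or orthogonal to, a shorter one. -/
theorem proj_mul_proj_of_le {μ ν : List (Fin n)} (h : μ.length ≤ ν.length) :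
    proj μ * proj ν = 0 ∨ proj μ * proj ν = proj ν := by
  obtain ⟨ν₁, ν₂, rfl, hν⟩ : ∃ ν₁ ν₂, ν = ν₁ ++ ν₂ ∧ μ.length = ν₁.length :=
    ⟨ν.take μ.length, ν.drop μ.length, by simp, by simp [h]⟩
  have h1 : proj μ * proj (ν₁ ++ ν₂) =
      word μ * (star (word μ) * word ν₁) * word ν₂ * star (word (ν₁ ++ ν₂)) := by
    simp only [proj, word_append, mul_assoc]
  rw [h1, star_word_mul_word hν]
  split_ifs with hμ
  · right
    rw [hμ, mul_one, ← word_append, proj]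
  · left
    simp

theorem proj_comm (μ ν : List (Fin n)) : proj μ * proj ν = proj ν * proj μ := by
  wlog h : μ.length ≤ ν.length generalizing μ ν
  · exact (this ν μ (by omega)).symm
  rcases proj_mul_proj_of_le h with h | h
  · have := congrArg star h
    rw [star_mul, star_proj, star_proj, star_zero] at this
    rw [h, this]
  · have := congrArg star h
    rw [star_mul, star_proj, star_proj] at this
    rw [h, this]

theorem diag_comm {x y : CuntzAlgebra n} (hx : x ∈ diag n) (hy : y ∈ diag n) :
    x * y = y * x := by
  have hle (z : CuntzAlgebra n)
      (h : ∀ μ, proj μ * z = z * proj μ ∧ proj μ * star z = star z * proj μ) :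
      ∀ x ∈ diag n, z * x = x * z := by
    have : diag n ≤ StarSubalgebra.centralizer ℂ {z} := by
      refine StarSubalgebra.topologicalClosure_minimal (StarAlgebra.adjoin_le ?_) ?_
      · rintro _ ⟨μ, rfl⟩
        refine (StarSubalgebra.mem_centralizer_iff ℂ).2 ?_
        rintro _ rfl
        exact ⟨(h μ).1.symm, (h μ).2.symm⟩
      · exact Set.isClosed_centralizer _
    exact fun x hx => ((StarSubalgebra.mem_centralizer_iff ℂ).1 (this hx) z rfl).1
  have h1 (μ : List (Fin n)) : ∀ x ∈ diag n, proj μ * x = x * proj μ :=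
    hle _ fun ν => ⟨proj_comm _ _, by rw [star_proj, proj_comm]⟩
  exact hle x (fun μ => ⟨h1 μ x hx, h1 μ _ (star_mem hx)⟩) y hy

theorem shift_proj (μ : List (Fin n)) : shift n (proj μ) = ∑ i, proj (i :: μ) := by
  simp only [shift_apply, proj, word_cons, star_mul, mul_assoc]

theorem proj_mul_iterate_shift (μ : List (Fin n)) (x : CuntzAlgebra n) :
    proj μ * (shift n)^[μ.length] x = word μ * x * star (word μ) := by
  have := star_fword_mul_iterate_shift μ.get x
  rw [fword, List.ofFn_get] at this
  rw [proj, mul_assoc, this, mul_assoc]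

theorem proj_append (μ ν : List (Fin n)) :
    proj (μ ++ ν) = proj μ * (shift n)^[μ.length] (proj ν) := by
  rw [proj_mul_iterate_shift, proj, proj, word_append, star_mul]
  simp only [mul_assoc]

theorem sum_proj_append (n k : ℕ) (μ : List (Fin n)) :
    ∑ κ : Fin k → Fin n, proj (μ ++ List.ofFn κ) = proj μ := by
  simp only [proj, word_append, star_mul, mul_assoc]
  simp only [← mul_assoc (word (List.ofFn _)), ← Finset.mul_sum, ← Finset.sum_mul]
  rw [show ∑ κ : Fin k → Fin n, word (List.ofFn κ) * star (word (List.ofFn κ)) = 1 from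
    sum_fword_mul_star n k, one_mul]

theorem sum_proj (n k : ℕ) : ∑ κ : Fin k → Fin n, proj (List.ofFn κ) = 1 :=
  sum_fword_mul_star n k

theorem norm_le_one_of_isStarProjection {p : CuntzAlgebra n} (hp : IsStarProjection p) :
    ‖p‖ ≤ 1 := by
  have h := CStarRing.norm_star_mul_self (x := p)
  rw [hp.isSelfAdjoint.star_eq, hp.isIdempotentElem.eq] at h
  nlinarith [norm_nonneg p]

/-- Elements of the dense `*`-subalgebra generated by the cylinder projections are constant on
all sufficiently small cylinders. -/
theorem exists_mul_proj_eq_smul {a : CuntzAlgebra n}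
    (ha : a ∈ StarAlgebra.adjoin ℂ (Set.range (proj (n := n)))) :
    ∃ K, ∀ μ : List (Fin n), K ≤ μ.length → ∃ c : ℂ, a * proj μ = c • proj μ := by
  induction ha using StarAlgebra.adjoin_induction with
  | mem x hx =>
    obtain ⟨ν, rfl⟩ := hx
    refine ⟨ν.length, fun μ hμ => ?_⟩
    rcases proj_mul_proj_of_le hμ with h | h
    · exact ⟨0, by simp [h]⟩
    · exact ⟨1, by simp [h]⟩
  | algebraMap r =>
    exact ⟨0, fun μ _ => ⟨r, by rw [Algebra.algebraMap_eq_smul_one, smul_mul_assoc, one_mul]⟩⟩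
  | add x y _ _ hx hy =>
    obtain ⟨K, hK⟩ := hx
    obtain ⟨L, hL⟩ := hy
    refine ⟨K + L, fun μ hμ => ?_⟩
    obtain ⟨c, hc⟩ := hK μ (by omega)
    obtain ⟨d, hd⟩ := hL μ (by omega)
    exact ⟨c + d, by rw [add_mul, hc, hd, add_smul]⟩
  | mul x y _ _ hx hy =>
    obtain ⟨K, hK⟩ := hx
    obtain ⟨L, hL⟩ := hy
    refine ⟨K + L, fun μ hμ => ?_⟩
    obtain ⟨c, hc⟩ := hK μ (by omega)
    obtain ⟨d, hd⟩ := hL μ (by omega)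
    exact ⟨d * c, by rw [mul_assoc, hd, mul_smul_comm, hc, smul_smul]⟩
  | star x hx' hx =>
    obtain ⟨K, hK⟩ := hx
    refine ⟨K, fun μ hμ => ?_⟩
    obtain ⟨c, hc⟩ := hK μ hμ
    refine ⟨star c, ?_⟩
    have hx : x ∈ diag n := StarSubalgebra.le_topologicalClosure _ hx'
    have := congrArg star hc
    rw [star_mul, star_smul, star_proj] at this
    rw [diag_comm (star_mem hx) (proj_mem_diag μ), this]

/-- A projection in `𝒟_n` lies in some `𝒟_n^K`: it is constant on all sufficiently small
cylinders, being close to an element that is. -/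
theorem exists_mul_proj_eq_zero_or {p : CuntzAlgebra n} (hp : IsStarProjection p)
    (hd : p ∈ diag n) :
    ∃ K, ∀ μ : List (Fin n), K ≤ μ.length → p * proj μ = 0 ∨ p * proj μ = proj μ := by
  obtain ⟨a, ha, hpa⟩ : ∃ a ∈ StarAlgebra.adjoin ℂ (Set.range (proj (n := n))),
      ‖p - a‖ < 1 / 2 := by
    have : p ∈ closure (StarAlgebra.adjoin ℂ (Set.range (proj (n := n))) :
        Set (CuntzAlgebra n)) := by
      rw [← StarSubalgebra.topologicalClosure_coe]
      exact hd
    obtain ⟨a, ha, h⟩ := Metric.mem_closure_iff.1 this (1 / 2) (by norm_num)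
    exact ⟨a, ha, by rwa [← dist_eq_norm]⟩
  obtain ⟨K, hK⟩ := exists_mul_proj_eq_smul ha
  refine ⟨K, fun μ hμ => ?_⟩
  obtain ⟨c, hc⟩ := hK μ hμ
  have hcomm := diag_comm hd (proj_mem_diag μ)
  have hpp := hp.isIdempotentElem.eq
  have hee := (isStarProjection_proj μ).isIdempotentElem.eq
  set e := proj μ with he
  -- `q` and `r` are the parts of the cylinder on which `p` is `1` and `0`.
  have hq : IsStarProjection (p * e) := hp.mul (isStarProjection_proj μ) hcomm
  have hr : IsStarProjection (e - p * e) := by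
    refine ⟨?_, ?_⟩
    · have h1 : p * e * e = p * e := by rw [mul_assoc, hee]
      have h2 : e * (p * e) = p * e := by rw [← mul_assoc, ← hcomm, h1]
      rw [IsIdempotentElem, mul_sub, sub_mul, sub_mul, hq.isIdempotentElem.eq, h1, h2, hee]
      simp
    · exact (isStarProjection_proj μ).isSelfAdjoint.sub hq.isSelfAdjoint
  -- If both are nonzero, `a` is within `1 / 2` of both `0` and `1` on the cylinder.
  by_contra! hne
  have hbound {q : CuntzAlgebra n} (hq : IsStarProjection q) (h0 : q ≠ 0) {d : ℂ}
      (h : (p - a) * q = d • q) : ‖d‖ < 1 / 2 := by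
    have h1 : ‖d‖ * ‖q‖ ≤ ‖p - a‖ * ‖q‖ := by
      rw [← norm_smul, ← h]
      exact norm_mul_le _ _
    exact (le_of_mul_le_mul_right h1 (norm_pos_iff.2 h0)).trans_lt hpa
  have h1 : ‖1 - c‖ < 1 / 2 := by
    refine hbound hq hne.1 ?_
    rw [sub_mul, ← mul_assoc, hpp, hcomm, ← mul_assoc, hc, sub_smul, one_smul, smul_mul_assoc]
  have h2 : ‖-c‖ < 1 / 2 := by
    refine hbound hr (sub_ne_zero.2 hne.2.symm) ?_
    have : p * (e - p * e) = 0 := by rw [mul_sub, ← mul_assoc, hpp, sub_self]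
    rw [sub_mul, this, mul_sub, hc, hcomm, ← mul_assoc, hc, smul_mul_assoc, neg_smul, smul_sub,
      zero_sub]
  have h3 : ‖(1 : ℂ)‖ ≤ ‖1 - c‖ + ‖-c‖ := by
    have := norm_sub_le (1 - c) (-c)
    simpa using this
  rw [norm_one] at h3
  linarith

theorem continuous_diagAut (α : diag n ≃⋆ₐ[ℂ] diag n) : Continuous α := by
  let _ : CStarAlgebra (diag n) := StarSubalgebra.cstarAlgebra (diag n)
    (h_closed := StarSubalgebra.isClosed_topologicalClosure _)
  exact AddMonoidHomClass.continuous_of_bound α 1 fun x => by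
    simpa using NonUnitalStarAlgHom.norm_apply_le α x

theorem continuous_shift (n : ℕ) : Continuous (shift n) :=
  AddMonoidHomClass.continuous_of_bound (shift n) 1 fun x => by
    simpa using NonUnitalStarAlgHom.norm_apply_le (shift n) x

theorem continuous_diagShift (n : ℕ) : Continuous (diagShift n) :=
  ((continuous_shift n).comp continuous_subtype_val).subtype_mk _

/-- `P_μ` as an element of `𝒟_n`. -/
def dproj (μ : List (Fin n)) : diag n := ⟨proj μ, proj_mem_diag μ⟩

theorem coe_dproj (μ : List (Fin n)) : (dproj μ : CuntzAlgebra n) = proj μ := rfl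

/-- Continuous `*`-homomorphisms on `𝒟_n` are determined by their values on the `P_μ`. -/
theorem diag_hom_ext {B : Type*} [Semiring B] [Algebra ℂ B] [StarRing B] [TopologicalSpace B]
    [T2Space B] {f g : diag n →⋆ₐ[ℂ] B} (hf : Continuous f) (hg : Continuous g)
    (h : ∀ μ, f (dproj μ) = g (dproj μ)) : f = g := by
  refine StarAlgHom.ext_topologicalClosure (φ := f) (ψ := g) hf hg ?_
  refine StarAlgHom.ext_adjoin fun x hx => ?_
  obtain ⟨x, hx'⟩ := x
  obtain ⟨μ, rfl⟩ := hx
  exact h μ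

theorem diag_mul_comm (x y : diag n) : x * y = y * x :=
  Subtype.ext (diag_comm x.2 y.2)

theorem dproj_mul_dproj {μ ν : List (Fin n)} (h : μ.length = ν.length) :
    dproj μ * dproj ν = if μ = ν then dproj μ else 0 := by
  apply Subtype.ext
  rw [MulMemClass.coe_mul, coe_dproj, coe_dproj, proj_mul_proj h]
  split_ifs <;> rfl

theorem dproj_ne_zero (hn : n ≠ 0) (μ : List (Fin n)) : dproj μ ≠ 0 := fun h =>
  proj_ne_zero hn μ (congrArg Subtype.val h)

theorem star_dproj (μ : List (Fin n)) : star (dproj μ) = dproj μ :=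
  Subtype.ext (star_proj μ)

theorem dproj_append (μ ν : List (Fin n)) :
    dproj (μ ++ ν) = dproj μ * (diagShift n)^[μ.length] (dproj ν) := by
  apply Subtype.ext
  rw [MulMemClass.coe_mul, coe_iterate_diagShift]
  exact proj_append μ ν

theorem dproj_cons (i : Fin n) (ν : List (Fin n)) :
    dproj (i :: ν) = dproj [i] * diagShift n (dproj ν) :=
  dproj_append [i] ν

theorem sum_dproj_append (n k : ℕ) (μ : List (Fin n)) :
    ∑ κ : Fin k → Fin n, dproj (μ ++ List.ofFn κ) = dproj μ := by
  apply Subtype.ext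
  rw [AddSubmonoidClass.coe_finsetSum]
  exact sum_proj_append n k μ

theorem sum_dproj (n k : ℕ) : ∑ κ : Fin k → Fin n, dproj (List.ofFn κ) = 1 := by
  apply Subtype.ext
  rw [AddSubmonoidClass.coe_finsetSum]
  exact sum_proj n k

theorem sum_dproj_singleton (n : ℕ) : ∑ i : Fin n, dproj [i] = 1 := by
  apply Subtype.ext
  rw [AddSubmonoidClass.coe_finsetSum]
  simpa [coe_dproj, proj, word] using sum_S_mul_star_S n

theorem coe_dproj_singleton_mul_diagShift (i : Fin n) (x : diag n) :
    (dproj [i] * diagShift n x : CuntzAlgebra n) = S i * x * star (S i) := by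
  have := proj_mul_iterate_shift [i] (x : CuntzAlgebra n)
  rw [coe_dproj, coe_diagShift]
  simpa [word] using this

theorem coe_pow_diagShift (k : ℕ) : ⇑((diagShift n) ^ k) = (diagShift n)^[k] := by
  induction k with
  | zero => rfl
  | succ k ih => rw [pow_succ', Function.iterate_succ', ← ih]; rfl

theorem continuous_pow_diagShift (n k : ℕ) : Continuous ((diagShift n) ^ k) := by
  rw [coe_pow_diagShift]
  exact (continuous_diagShift n).iterate k

/-! ### Property (P) and the endomorphism `α φ α⁻¹` -/

/-- The unital `*`-endomorphism `α φ α⁻¹` of `𝒟_n`. -/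
def shiftConj (α : diag n ≃⋆ₐ[ℂ] diag n) : diag n →⋆ₐ[ℂ] diag n where
  toFun x := α (diagShift n (α.symm x))
  map_one' := by simp
  map_mul' _ _ := by simp
  map_zero' := by simp
  map_add' _ _ := by simp
  commutes' r := by simp [Algebra.algebraMap_eq_smul_one]
  map_star' _ := by simp [map_star]

theorem shiftConj_apply (α : diag n ≃⋆ₐ[ℂ] diag n) (x : diag n) :
    shiftConj α x = α (diagShift n (α.symm x)) := rfl

theorem continuous_shiftConj (α : diag n ≃⋆ₐ[ℂ] diag n) : Continuous (shiftConj α) :=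
  (continuous_diagAut α).comp ((continuous_diagShift n).comp (continuous_diagAut α.symm))

/-- Property (P) of `α⁻¹` says that `α φ α⁻¹` agrees with `φ` on the range of `φ^m`. -/
theorem exists_shiftConj_iterate {α : diag n ≃⋆ₐ[ℂ] diag n} (h : PropertyP α.symm) :
    ∃ m, ∀ k ≥ m, ∀ x : diag n,
      shiftConj α ((diagShift n)^[k] x) = (diagShift n)^[k + 1] x := by
  obtain ⟨m, hm⟩ := h
  have hgen (k : ℕ) (hk : m ≤ k) (i : Fin n) :
      shiftConj α ((diagShift n)^[k] (dproj [i])) = (diagShift n)^[k + 1] (dproj [i]) := by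
    have hi : ((dproj [i] : diag n) : CuntzAlgebra n) ∈ diagLevel n 1 :=
      ⟨(dproj [i]).2, StarAlgebra.subset_adjoin ℂ _ ⟨[i], [i], rfl, rfl, rfl⟩⟩
    rw [shiftConj_apply, hm k hk _ hi, ← Function.iterate_succ_apply' (diagShift n),
      ← Nat.succ_sub hk, ← hm (k + 1) (by omega) _ hi, α.apply_symm_apply]
  have hproj (μ : List (Fin n)) (k : ℕ) (hk : m ≤ k) :
      shiftConj α ((diagShift n)^[k] (dproj μ)) = (diagShift n)^[k + 1] (dproj μ) := by
    induction μ generalizing k with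
    | nil =>
      have : (dproj [] : diag n) = 1 := Subtype.ext (by simp [coe_dproj, proj])
      rw [this, iterate_map_one, iterate_map_one, map_one]
    | cons i μ ih =>
      rw [dproj_cons, iterate_map_mul, iterate_map_mul, map_mul, hgen k hk,
        ← Function.iterate_succ_apply, ← Function.iterate_succ_apply, ih _ (by omega)]
  refine ⟨m, fun k hk x => ?_⟩
  have := diag_hom_ext (f := (shiftConj α).comp ((diagShift n) ^ k))
    (g := (diagShift n) ^ (k + 1)) ((continuous_shiftConj α).comp (continuous_pow_diagShift n k))
    (continuous_pow_diagShift n _) fun μ => by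
      rw [coe_pow_diagShift, StarAlgHom.comp_apply, coe_pow_diagShift, hproj μ k hk]
  have := DFunLike.congr_fun this x
  rwa [coe_pow_diagShift, StarAlgHom.comp_apply, coe_pow_diagShift] at this

/-- The image of `P_ν` under the endomorphism `S_i y S_i^* ↦ α(S_i α⁻¹(y) S_i^*)` of `𝒟_n`, which
for `α = λ_u` is the restriction of `Ad(u)`. In terms of `P_{iν} = P_i φ(P_ν)` it is
`α(P_i) · α φ α⁻¹(P_ν)`. -/
def cyl (α : diag n ≃⋆ₐ[ℂ] diag n) : List (Fin n) → diag n
  | [] => 1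
  | i :: ν => α (dproj [i]) * shiftConj α (dproj ν)

theorem cyl_cons (α : diag n ≃⋆ₐ[ℂ] diag n) (i : Fin n) (ν : List (Fin n)) :
    cyl α (i :: ν) = α (dproj [i]) * shiftConj α (dproj ν) := rfl

theorem cyl_mul_cyl (α : diag n ≃⋆ₐ[ℂ] diag n) {μ ν : List (Fin n)}
    (h : μ.length = ν.length) : cyl α μ * cyl α ν = if μ = ν then cyl α μ else 0 := by
  match μ, ν, h with
  | [], [], _ => simp [cyl]
  | i :: μ, j :: ν, h =>
    have h1 : cyl α (i :: μ) * cyl α (j :: ν) =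
        α (dproj [i] * dproj [j]) * shiftConj α (dproj μ * dproj ν) := by
      rw [cyl_cons, cyl_cons, map_mul, map_mul, mul_assoc, mul_assoc,
        ← mul_assoc (shiftConj α _) (α _), diag_mul_comm (shiftConj α _) (α _), mul_assoc]
    rw [h1, dproj_mul_dproj (show [i].length = [j].length from rfl),
      dproj_mul_dproj (Nat.succ.inj h)]
    by_cases hij : i = j <;> by_cases hμ : μ = ν <;> simp [hij, hμ, cyl_cons]

theorem isStarProjection_cyl (α : diag n ≃⋆ₐ[ℂ] diag n) (ν : List (Fin n)) :
    IsStarProjection (cyl α ν : CuntzAlgebra n) := by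
  have h : star (cyl α ν) = cyl α ν := by
    cases ν with
    | nil => simp [cyl]
    | cons i ν =>
      rw [cyl_cons, star_mul, ← map_star, ← map_star, star_dproj, star_dproj, diag_mul_comm]
  refine ⟨?_, congrArg Subtype.val h⟩
  have := cyl_mul_cyl α (rfl : ν.length = ν.length)
  rw [if_pos rfl] at this
  exact congrArg Subtype.val this

theorem cyl_ne_zero (hn : n ≠ 0) (α : diag n ≃⋆ₐ[ℂ] diag n) {ν : List (Fin n)} (hν : ν ≠ []) :
    cyl α ν ≠ 0 := by
  match ν, hν with
  | i :: ν, _ =>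
    intro h
    rw [cyl_cons, shiftConj_apply, ← map_mul, map_eq_zero_iff α α.injective] at h
    have h1 : S i * (α.symm (dproj ν) : CuntzAlgebra n) * star (S i) = 0 := by
      rw [← coe_dproj_singleton_mul_diagShift]
      exact congrArg Subtype.val h
    have h2 : (α.symm (dproj ν) : CuntzAlgebra n) = 0 := by
      calc (α.symm (dproj ν) : CuntzAlgebra n)
          = star (S i) * (S i * (α.symm (dproj ν) : CuntzAlgebra n) * star (S i)) * S i := by
            rw [mul_assoc (S i), ← mul_assoc (star (S i)), star_S_mul_S, one_mul, mul_assoc,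
              star_S_mul_S, mul_one]
        _ = 0 := by rw [h1, mul_zero, zero_mul]
    have h3 : α.symm (dproj ν) = 0 := Subtype.ext h2
    exact dproj_ne_zero hn ν ((map_eq_zero_iff α.symm α.symm.injective).1 h3)

theorem sum_cyl_append (α : diag n ≃⋆ₐ[ℂ] diag n) (k : ℕ) {μ : List (Fin n)} (hμ : μ ≠ []) :
    ∑ κ : Fin k → Fin n, cyl α (μ ++ List.ofFn κ) = cyl α μ := by
  match μ, hμ with
  | i :: μ, _ =>
    simp only [List.cons_append, cyl_cons]
    rw [← Finset.mul_sum, ← map_sum, sum_dproj_append]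

theorem sum_cyl_cons (α : diag n ≃⋆ₐ[ℂ] diag n) (ν : List (Fin n)) :
    ∑ i, cyl α (i :: ν) = shiftConj α (dproj ν) := by
  simp only [cyl_cons]
  rw [← Finset.sum_mul, ← map_sum, sum_dproj_singleton, map_one, one_mul]

theorem cyl_append {α : diag n ≃⋆ₐ[ℂ] diag n} {m : ℕ}
    (hm : ∀ k ≥ m, ∀ x : diag n, shiftConj α ((diagShift n)^[k] x) = (diagShift n)^[k + 1] x)
    {μ : List (Fin n)} (hμ : m + 1 ≤ μ.length) (ν : List (Fin n)) :
    cyl α (μ ++ ν) = cyl α μ * (diagShift n)^[μ.length] (dproj ν) := by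
  match μ, hμ with
  | i :: μ, hμ =>
    rw [List.cons_append, cyl_cons, cyl_cons, dproj_append, map_mul,
      hm _ (by simpa using hμ), mul_assoc, List.length_cons]

/-- For large `k`, each `cyl α ν` with `|ν| = k` is a sum of cylinder projections `P_μ` with
`|μ| = k`. -/
theorem exists_cyl_mul_dproj {α : diag n ≃⋆ₐ[ℂ] diag n} {m : ℕ}
    (hm : ∀ k ≥ m, ∀ x : diag n, shiftConj α ((diagShift n)^[k] x) = (diagShift n)^[k + 1] x) :
    ∃ k ≥ m + 1, ∀ μ ν : List (Fin n), μ.length = k → ν.length = k →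
      cyl α ν * dproj μ = 0 ∨ cyl α ν * dproj μ = dproj μ := by
  choose K hK using fun κ : Fin (m + 1) → Fin n =>
    exists_mul_proj_eq_zero_or (isStarProjection_cyl α (List.ofFn κ)) (cyl α (List.ofFn κ)).2
  refine ⟨m + 1 + ∑ κ, K κ, by omega, fun μ ν hμ hν => ?_⟩
  have hsplit (μ : List (Fin n)) (h : m + 1 ≤ μ.length) :
      ∃ (κ : Fin (m + 1) → Fin n) (ω : List (Fin n)), μ = List.ofFn κ ++ ω := by
    obtain ⟨κ, hκ⟩ := exists_ofFn_eq (μ := μ.take (m + 1)) (k := m + 1) (by simpa using h)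
    exact ⟨κ, μ.drop (m + 1), by rw [hκ, List.take_append_drop]⟩
  obtain ⟨κ, ω, rfl⟩ := hsplit ν (by omega)
  obtain ⟨κ', ω', rfl⟩ := hsplit μ (by omega)
  rw [cyl_append hm (by simp), List.length_ofFn]
  have h1 : (diagShift n)^[m + 1] (dproj ω) * dproj (List.ofFn κ' ++ ω') = 0 ∨
      (diagShift n)^[m + 1] (dproj ω) * dproj (List.ofFn κ' ++ ω') =
        dproj (List.ofFn κ' ++ ω') := by
    rw [dproj_append, List.length_ofFn, diag_mul_comm (dproj _), ← mul_assoc, ← iterate_map_mul,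
      dproj_mul_dproj (by simp at hμ hν; omega)]
    split_ifs with h
    · right; rw [h]
    · left; rw [iterate_map_zero, zero_mul]
  rcases h1 with h1 | h1
  · left
    rw [mul_assoc, h1, mul_zero]
  · rw [mul_assoc, h1]
    have hle : K κ ≤ (List.ofFn κ' ++ ω').length := by
      rw [hμ]
      have := Finset.single_le_sum (f := K) (fun _ _ => Nat.zero_le _) (Finset.mem_univ κ)
      omega
    exact (hK κ _ hle).imp (fun h => Subtype.ext h) fun h => Subtype.ext h

/-- For large `k`, the endomorphism `S_i y S_i^* ↦ α(S_i α⁻¹(y) S_i^*)` permutes the cylinder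
projections of length `k`. -/
theorem exists_perm_cyl_eq_dproj (hn : n ≠ 0) {α : diag n ≃⋆ₐ[ℂ] diag n} {k : ℕ} (hk : k ≠ 0)
    (h : ∀ μ ν : List (Fin n), μ.length = k → ν.length = k →
      cyl α ν * dproj μ = 0 ∨ cyl α ν * dproj μ = dproj μ) :
    ∃ f : Equiv.Perm (Fin k → Fin n), ∀ ν, cyl α (List.ofFn ν) = dproj (List.ofFn (f ν)) := by
  have hne (ν : Fin k → Fin n) : List.ofFn ν ≠ [] := by
    intro h0
    have := congrArg List.length h0
    simp at this
    exact hk this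
  have hex (ν : Fin k → Fin n) : ∃ μ : Fin k → Fin n,
      cyl α (List.ofFn ν) * dproj (List.ofFn μ) = dproj (List.ofFn μ) := by
    -- Otherwise `cyl α ν` is orthogonal to all `P_μ`, which sum to `1`.
    by_contra! hcon
    refine cyl_ne_zero hn α (hne ν) ?_
    rw [← mul_one (cyl α _), ← sum_dproj n k, Finset.mul_sum]
    exact Finset.sum_eq_zero fun μ _ =>
      (h _ _ (by simp) (by simp)).resolve_right (hcon μ)
  choose f hf using hex
  have hmul (ν ν' : Fin k → Fin n) : cyl α (List.ofFn ν) * dproj (List.ofFn (f ν')) =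
      if ν = ν' then dproj (List.ofFn (f ν')) else 0 := by
    rw [← hf ν', ← mul_assoc, cyl_mul_cyl α (by simp)]
    by_cases hν : ν = ν' <;> simp [hν, List.ofFn_inj]
  have hinj : Function.Injective f := by
    intro ν ν' hff
    by_contra hν
    have := hmul ν ν'
    rw [if_neg hν, ← hff, hf] at this
    exact dproj_ne_zero hn _ this
  have hbij : Function.Bijective f := Finite.injective_iff_bijective.1 hinj
  refine ⟨Equiv.ofBijective f hbij, fun ν => ?_⟩
  calc cyl α (List.ofFn ν)
      = ∑ ν', cyl α (List.ofFn ν) * dproj (List.ofFn (f ν')) := by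
        rw [hbij.sum_comp (fun μ => cyl α (List.ofFn ν) * dproj (List.ofFn μ)),
          ← Finset.mul_sum, sum_dproj, mul_one]
    _ = _ := by simp [hmul]

/-- The unitary `∑ S_{f(ν)} S_ν^*` attached to a permutation `f` of the multi-indices of length
`k`. -/
def permUnitary {k : ℕ} (f : Equiv.Perm (Fin k → Fin n)) : unitary (CuntzAlgebra n) :=
  ⟨∑ ν, fword (f ν) * star (fword ν), by
    have key (f g : Equiv.Perm (Fin k → Fin n)) :
        (∑ ν, fword (f ν) * star (fword (g ν))) * ∑ ν, fword (g ν) * star (fword (f ν)) = 1 := by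
      rw [Finset.sum_mul_sum]
      calc _ = ∑ ν, fword (f ν) * star (fword (f ν)) := by
            refine Finset.sum_congr rfl fun ν _ => ?_
            rw [Finset.sum_eq_single ν]
            · rw [mul_assoc, ← mul_assoc (star _), star_fword_mul_fword, if_pos rfl, one_mul]
            · intro ν' _ h
              rw [mul_assoc, ← mul_assoc (star _), star_fword_mul_fword,
                if_neg (g.injective.ne h.symm), zero_mul, mul_zero]
            · simp
        _ = 1 := by
            rw [Equiv.sum_comp f (fun ν => fword ν * star (fword ν)), sum_fword_mul_star]
    have hst : star (∑ ν, fword (f ν) * star (fword ν)) = ∑ ν, fword ν * star (fword (f ν)) := by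
      simp [star_sum]
    rw [Unitary.mem_iff, hst]
    exact ⟨key (Equiv.refl _) f, key f (Equiv.refl _)⟩⟩

theorem coe_permUnitary {k : ℕ} (f : Equiv.Perm (Fin k → Fin n)) :
    (permUnitary f : CuntzAlgebra n) = ∑ ν, fword (f ν) * star (fword ν) := rfl

theorem permUnitary_mem_coreLevel {k : ℕ} (f : Equiv.Perm (Fin k → Fin n)) :
    (permUnitary f : CuntzAlgebra n) ∈ coreLevel n k :=
  sum_mem fun _ _ => fword_mul_star_mem_coreLevel _ _

theorem permUnitary_mem_permUnitaries {k : ℕ} (f : Equiv.Perm (Fin k → Fin n)) :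
    permUnitary f ∈ permUnitaries n := by
  refine ⟨?_, coreLevel_le_core k (permUnitary_mem_coreLevel f)⟩
  let e := Fintype.equivFin (Fin k → Fin n)
  exact ⟨_, fun j => List.ofFn (f (e.symm j)), fun j => List.ofFn (e.symm j),
    (Equiv.sum_comp e.symm fun ν => fword (f ν) * star (fword ν)).symm⟩

theorem permUnitary_conj_proj {k : ℕ} (f : Equiv.Perm (Fin k → Fin n)) (ν : Fin k → Fin n) :
    (permUnitary f : CuntzAlgebra n) * proj (List.ofFn ν) * star (permUnitary f : CuntzAlgebra n) =
      proj (List.ofFn (f ν)) := by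
  have h : (permUnitary f : CuntzAlgebra n) * word (List.ofFn ν) = word (List.ofFn (f ν)) := by
    change _ * fword ν = fword (f ν)
    rw [coe_permUnitary, Finset.sum_mul, Finset.sum_eq_single ν]
    · rw [mul_assoc, star_fword_mul_fword, if_pos rfl, mul_one]
    · intro ν' _ h
      rw [mul_assoc, star_fword_mul_fword, if_neg h, mul_zero]
    · simp
  rw [proj, ← mul_assoc, h, mul_assoc, ← star_mul, h, proj]

/-- `Ad(u) φ` as a unital `*`-homomorphism `𝒟_n → 𝒪_n`. -/
def conjShift (u : unitary (CuntzAlgebra n)) : diag n →⋆ₐ[ℂ] CuntzAlgebra n where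
  toFun x := u * shift n x * star (u : CuntzAlgebra n)
  map_one' := by simp
  map_mul' x y := by
    simp only [MulMemClass.coe_mul, map_mul, mul_assoc]
    rw [← mul_assoc (star (u : CuntzAlgebra n)) (u : CuntzAlgebra n),
      Unitary.star_mul_self_of_mem u.2, one_mul]
  map_zero' := by simp
  map_add' _ _ := by simp [mul_add, add_mul]
  commutes' r := by simp [Algebra.algebraMap_eq_smul_one]
  map_star' _ := by simp [map_star, mul_assoc]

theorem exists_permUnitary_of_propertyP (hn : n ≠ 0) {α : diag n ≃⋆ₐ[ℂ] diag n}
    (h : PropertyP α.symm) :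
    ∃ u ∈ permUnitaries n, ∀ x : diag n, (α x : CuntzAlgebra n) = endo u x := by
  obtain ⟨m, hm⟩ := exists_shiftConj_iterate h
  obtain ⟨k, hk, hcyl⟩ := exists_cyl_mul_dproj hm
  obtain ⟨f, hf⟩ := exists_perm_cyl_eq_dproj hn (by omega) hcyl
  let u := permUnitary f
  refine ⟨u, permUnitary_mem_permUnitaries f, ?_⟩
  -- `Ad(u)` and the endomorphism defining `cyl` agree on cylinders of length `k` and fix the range
  -- of `φ^k`; shorter cylinders are sums of long ones.
  have hlong (ν : List (Fin n)) (hν : k ≤ ν.length) :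
      (cyl α ν : CuntzAlgebra n) = u * proj ν * star (u : CuntzAlgebra n) := by
    obtain ⟨κ, hκ⟩ := exists_ofFn_eq (μ := ν.take k) (k := k) (by simpa using hν)
    obtain ⟨ω, rfl⟩ : ∃ ω, ν = List.ofFn κ ++ ω :=
      ⟨ν.drop k, by rw [hκ, List.take_append_drop]⟩
    rw [cyl_append hm (by simpa using hk), hf, MulMemClass.coe_mul, coe_iterate_diagShift,
      coe_dproj, coe_dproj, ← permUnitary_conj_proj, proj_append, List.length_ofFn, mul_assoc,
      ← iterate_shift_comm (star_mem (permUnitary_mem_coreLevel f))]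
    simp only [mul_assoc, u]
  have hall (ν : List (Fin n)) (hν : ν ≠ []) :
      (cyl α ν : CuntzAlgebra n) = u * proj ν * star (u : CuntzAlgebra n) := by
    rw [← sum_cyl_append α k hν, ← sum_proj_append n k ν, AddSubmonoidClass.coe_finsetSum,
      Finset.mul_sum, Finset.sum_mul]
    exact Finset.sum_congr rfl fun κ _ => hlong _ (by simp)
  -- Summing over the first letter turns this into `α φ α⁻¹ = Ad(u) φ` on all of `𝒟_n`.
  have hconj (x : diag n) : (shiftConj α x : CuntzAlgebra n) =
      u * shift n x * star (u : CuntzAlgebra n) := by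
    have := diag_hom_ext (f := (diag n).subtype.comp (shiftConj α)) (g := conjShift u)
      (continuous_subtype_val.comp (continuous_shiftConj α))
      (((continuous_const.mul ((continuous_shift n).comp continuous_subtype_val)).mul
        continuous_const)) fun ν => by
        change (shiftConj α (dproj ν) : CuntzAlgebra n) =
          u * shift n (proj ν) * star (u : CuntzAlgebra n)
        rw [← sum_cyl_cons, AddSubmonoidClass.coe_finsetSum, shift_proj, Finset.mul_sum,
          Finset.sum_mul]
        exact Finset.sum_congr rfl fun i _ => hall _ (by simp)
    exact DFunLike.congr_fun this x
  have hsingle (i : Fin n) : (α (dproj [i]) : CuntzAlgebra n) =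
      u * proj [i] * star (u : CuntzAlgebra n) := by
    rw [← hall [i] (by simp), cyl_cons, show (dproj [] : diag n) = 1 from
      Subtype.ext (by simp [coe_dproj, proj]), map_one, mul_one]
  have hword (ν : List (Fin n)) : (α (dproj ν) : CuntzAlgebra n) = endo u (proj ν) := by
    induction ν with
    | nil =>
      rw [show (dproj [] : diag n) = 1 from Subtype.ext (by simp [coe_dproj, proj]), map_one]
      simp [proj]
    | cons i ν ih =>
      have h1 : α (diagShift n (dproj ν)) = shiftConj α (α (dproj ν)) := by
        rw [shiftConj_apply, α.symm_apply_apply]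
      have h2 := coe_dproj_singleton_mul_diagShift i (α (dproj ν))
      rw [coe_dproj, coe_diagShift] at h2
      calc (α (dproj (i :: ν)) : CuntzAlgebra n)
          = u * (proj [i] * shift n (α (dproj ν))) * star (u : CuntzAlgebra n) := by
            rw [dproj_cons, map_mul, MulMemClass.coe_mul, h1, hconj, hsingle]
            simp only [mul_assoc]
            rw [← mul_assoc (star (u : CuntzAlgebra n)) (u : CuntzAlgebra n),
              Unitary.star_mul_self_of_mem u.2, one_mul]
        _ = endo u (proj (i :: ν)) := by
            rw [h2, ih, proj, proj, map_mul, map_mul, map_star, map_star, endo_word_cons,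
              star_mul, star_mul]
            simp only [mul_assoc]
  have := diag_hom_ext (f := (diag n).subtype.comp (α : diag n →⋆ₐ[ℂ] diag n))
    (g := (endo u).comp (diag n).subtype)
    (continuous_subtype_val.comp (continuous_diagAut α))
    ((continuous_endo u).comp continuous_subtype_val) hword
  exact DFunLike.congr_fun this

/-! ### The trace on the core -/

/-- The unital positive map `x ↦ n^{-k} ∑_{|μ| = k} S_μ^* x S_μ`. On `ℱ_n^k` it is the normalized
trace. -/
def wordAverage (n k : ℕ) : CuntzAlgebra n →ₗ[ℂ] CuntzAlgebra n where
  toFun x := ((n : ℂ) ^ k)⁻¹ • ∑ μ : Fin k → Fin n, star (fword μ) * x * fword μ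
  map_add' x y := by simp [mul_add, add_mul, Finset.sum_add_distrib]
  map_smul' c x := by
    simp only [mul_smul_comm, smul_mul_assoc, ← Finset.smul_sum, RingHom.id_apply]
    rw [smul_comm]

theorem wordAverage_apply (k : ℕ) (x : CuntzAlgebra n) : wordAverage n k x =
    ((n : ℂ) ^ k)⁻¹ • ∑ μ : Fin k → Fin n, star (fword μ) * x * fword μ := rfl

theorem wordAverage_one (hn : n ≠ 0) (k : ℕ) : wordAverage n k 1 = 1 := by
  have : ((n : ℂ) ^ k) ≠ 0 := pow_ne_zero _ (Nat.cast_ne_zero.2 hn)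
  simp only [wordAverage_apply, mul_one, star_fword_mul_fword, if_true]
  rw [Finset.sum_const, Finset.card_univ, Fintype.card_fun, Fintype.card_fin, Fintype.card_fin,
    ← Nat.cast_smul_eq_nsmul ℂ, smul_smul, Nat.cast_pow, inv_mul_cancel₀ this, one_smul]

theorem norm_fword_le {k : ℕ} (μ : Fin k → Fin n) : ‖fword μ‖ ≤ 1 := by
  have h := CStarRing.norm_star_mul_self (x := fword μ)
  rw [star_fword_mul_fword, if_pos rfl] at h
  have h1 : ‖(1 : CuntzAlgebra n)‖ ≤ 1 :=
    norm_le_one_of_isStarProjection (IsStarProjection.one _)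
  nlinarith [norm_nonneg (fword μ)]

theorem norm_wordAverage_le (hn : n ≠ 0) (k : ℕ) (x : CuntzAlgebra n) :
    ‖wordAverage n k x‖ ≤ ‖x‖ := by
  have hpos : (0 : ℝ) < (n : ℝ) ^ k := by positivity
  have h1 (μ : Fin k → Fin n) : ‖star (fword μ) * x * fword μ‖ ≤ ‖x‖ := by
    calc ‖star (fword μ) * x * fword μ‖ ≤ ‖fword μ‖ * ‖x‖ * ‖fword μ‖ := by
          refine (norm_mul_le _ _).trans ?_
          gcongr
          refine (norm_mul_le _ _).trans ?_
          rw [norm_star]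
      _ ≤ 1 * ‖x‖ * 1 := by
          gcongr
          · exact norm_fword_le μ
          · exact norm_fword_le μ
      _ = ‖x‖ := by ring
  rw [wordAverage_apply, norm_smul, norm_inv, norm_pow, Complex.norm_natCast,
    inv_mul_le_iff₀ hpos]
  refine (norm_sum_le _ _).trans ((Finset.sum_le_sum fun μ _ => h1 μ).trans ?_)
  simp

/-- `ℱ_n^k` lies in the centralizer of the `k`-th average. -/
theorem wordAverage_mul_comm {k : ℕ} {x : CuntzAlgebra n} (hx : x ∈ coreLevel n k)
    (y : CuntzAlgebra n) : wordAverage n k (x * y) = wordAverage n k (y * x) := by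
  have key (μ ν : Fin k → Fin n) : wordAverage n k (fword μ * star (fword ν) * y) =
      wordAverage n k (y * (fword μ * star (fword ν))) := by
    rw [wordAverage_apply, wordAverage_apply]
    congr 1
    trans star (fword ν) * y * fword μ
    · rw [Finset.sum_eq_single μ]
      · rw [mul_assoc (fword μ), ← mul_assoc (star (fword μ)), star_fword_mul_fword, if_pos rfl,
          one_mul]
      · intro κ _ h
        rw [mul_assoc (fword μ), ← mul_assoc (star (fword κ)), star_fword_mul_fword, if_neg h,
          zero_mul, zero_mul]
      · simp
    · rw [Finset.sum_eq_single ν]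
      · simp only [mul_assoc, star_fword_mul_fword, if_true, mul_one]
      · intro κ _ h
        simp only [mul_assoc, star_fword_mul_fword, if_neg h.symm, mul_zero]
      · simp
  obtain ⟨c, rfl⟩ := eq_sum_of_mem_coreLevel hx
  simp only [Finset.sum_mul, Finset.mul_sum, smul_mul_assoc, mul_smul_comm, map_sum, map_smul, key]

/-- A Cuntz family and a unit vector give a state on the Cuntz algebra. -/
theorem exists_vectorState (hn : n ≠ 0) : ∃ ψ : CuntzAlgebra n →ₗ[ℂ] ℂ,
    ψ 1 = 1 ∧ (∀ x, 0 ≤ ψ (star x * x)) ∧ ∀ x, ‖ψ x‖ ≤ ‖x‖ := by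
  obtain ⟨T⟩ := nonempty_family hn
  obtain ⟨e, he⟩ := exists_norm_eq Hilb zero_le_one
  let π : CuntzAlgebra n →⋆ₐ[ℂ] (Hilb →L[ℂ] Hilb) := (Product.eval T).comp (incl n)
  let ψ : CuntzAlgebra n →ₗ[ℂ] ℂ :=
    { toFun := fun x => inner ℂ e (π x e)
      map_add' := fun x y => by simp
      map_smul' := fun c x => by simp }
  refine ⟨ψ, ?_, fun x => ?_, fun x => ?_⟩
  · change inner ℂ e (π 1 e) = 1
    rw [map_one, one_apply_eq_self, inner_self_eq_norm_sq_to_K, he]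
    simp
  · change 0 ≤ inner ℂ e (π (star x * x) e)
    rw [map_mul, map_star, mul_apply_eq_comp, ContinuousLinearMap.star_eq_adjoint,
      ContinuousLinearMap.adjoint_inner_right, inner_self_eq_norm_sq_to_K]
    exact pow_nonneg (Complex.zero_le_real.2 (norm_nonneg (π x e))) 2
  · change ‖inner ℂ e (π x e)‖ ≤ ‖x‖
    calc ‖inner ℂ e (π x e)‖ ≤ ‖e‖ * (‖π x‖ * ‖e‖) :=
          (norm_inner_le_norm _ _).trans (by gcongr; exact (π x).le_opNorm e)
      _ = ‖π x‖ := by rw [he, one_mul, mul_one]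
      _ ≤ ‖x‖ := NonUnitalStarAlgHom.norm_apply_le π x

/-- There is a state of `𝒪_n` with the core in its centralizer: an ultrafilter limit of a state
composed with the averages over words of growing length. -/
theorem exists_state_centralizing_core (hn : n ≠ 0) : ∃ τ : CuntzAlgebra n →ₗ[ℂ] ℂ,
    τ 1 = 1 ∧ (∀ x, 0 ≤ τ (star x * x)) ∧ ∀ x ∈ core n, ∀ y, τ (x * y) = τ (y * x) := by
  obtain ⟨ψ, hψ1, hψ0, hψn⟩ := exists_vectorState hn
  let f (k : ℕ) : CuntzAlgebra n →ₗ[ℂ] ℂ := ψ ∘ₗ wordAverage n k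
  have hfn (k : ℕ) (x : CuntzAlgebra n) : ‖f k x‖ ≤ ‖x‖ :=
    (hψn _).trans (norm_wordAverage_le hn k x)
  have hf0 (k : ℕ) (x : CuntzAlgebra n) : 0 ≤ f k (star x * x) := by
    change 0 ≤ ψ (wordAverage n k (star x * x))
    rw [wordAverage_apply, map_smul, map_sum, smul_eq_mul]
    have h1 : (0 : ℂ) ≤ ((n : ℂ) ^ k)⁻¹ := by
      have : (0 : ℝ) ≤ ((n : ℝ) ^ k)⁻¹ := by positivity
      have h1 := Complex.zero_le_real.2 this
      rwa [Complex.ofReal_inv, Complex.ofReal_pow, Complex.ofReal_natCast] at h1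
    refine mul_nonneg h1 (Finset.sum_nonneg fun μ _ => ?_)
    have := hψ0 (x * fword μ)
    rwa [star_mul, mul_assoc, ← mul_assoc (star x), ← mul_assoc (star (fword μ))] at this
  let U : Ultrafilter ℕ := Filter.hyperfilter ℕ
  have hlim (x : CuntzAlgebra n) : ∃ c : ℂ, ‖c‖ ≤ ‖x‖ ∧
      Filter.Tendsto (fun k => f k x) U (nhds c) := by
    obtain ⟨c, hc, h⟩ := (isCompact_closedBall (0 : ℂ) ‖x‖).ultrafilter_le_nhds
      (U.map fun k => f k x) (by
        rw [Filter.le_principal_iff, Ultrafilter.mem_coe, Ultrafilter.mem_map]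
        exact Filter.Eventually.of_forall fun k => by simpa using hfn k x)
    exact ⟨c, by simpa using hc, h⟩
  choose t htn ht using hlim
  let τ : CuntzAlgebra n →ₗ[ℂ] ℂ :=
    { toFun := t
      map_add' := fun x y => tendsto_nhds_unique (ht (x + y)) <| by
        simpa only [map_add] using (ht x).add (ht y)
      map_smul' := fun c x => tendsto_nhds_unique (ht (c • x)) <| by
        simpa only [map_smul, RingHom.id_apply] using (ht x).const_smul c }
  have hτ : Continuous τ := AddMonoidHomClass.continuous_of_bound τ 1 fun x => by
    rw [one_mul]
    exact htn x
  refine ⟨τ, ?_, fun x => ?_, fun x hx => ?_⟩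
  · refine tendsto_nhds_unique (ht 1) (tendsto_const_nhds.congr fun k => ?_)
    change 1 = ψ (wordAverage n k 1)
    rw [wordAverage_one hn, hψ1]
  · exact ge_of_tendsto' (ht (star x * x)) fun k => hf0 k x
  · have hcl : IsClosed {x : CuntzAlgebra n | ∀ y, τ (x * y) = τ (y * x)} := by
      simp only [Set.ofPred_forall]
      exact isClosed_iInter fun y => isClosed_eq (by fun_prop) (by fun_prop)
    rw [← SetLike.mem_coe, core_eq_closure_iUnion] at hx
    refine closure_minimal (Set.iUnion_subset fun k x hx y => ?_) hcl hx
    refine tendsto_nhds_unique_of_eventuallyEq (ht (x * y)) (ht (y * x)) ?_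
    refine (Nat.hyperfilter_le_atTop) (Filter.eventually_atTop.2 ⟨k, fun l hl => ?_⟩)
    change ψ (wordAverage n l (x * y)) = ψ (wordAverage n l (y * x))
    rw [wordAverage_mul_comm (coreLevel_mono hl hx)]

theorem exists_isNormalizedTrace (hn : n ≠ 0) :
    ∃ τ : core n →ₗ[ℂ] ℂ, IsNormalizedTrace τ := by
  obtain ⟨τ, h1, h0, hc⟩ := exists_state_centralizing_core hn
  let ι : core n →ₗ[ℂ] CuntzAlgebra n := (core n).subtype.toAlgHom.toLinearMap
  exact ⟨τ ∘ₗ ι, h1, fun x => h0 x, fun x y => hc x x.2 y⟩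

theorem IsNormalizedTrace.continuous {τ : core n →ₗ[ℂ] ℂ} (h : IsNormalizedTrace τ) :
    Continuous τ := by
  let _ : CStarAlgebra (core n) := StarSubalgebra.cstarAlgebra (core n)
    (h_closed := isClosed_core n)
  let _ := CStarAlgebra.spectralOrder (core n)
  let _ := CStarAlgebra.spectralOrderedRing (core n)
  let f : core n →ₚ[ℂ] ℂ := PositiveLinearMap.mk₀ τ fun x hx => by
    obtain ⟨y, rfl⟩ := CStarAlgebra.nonneg_iff_eq_star_mul_self.1 hx
    exact h.nonneg y
  obtain ⟨C, hC⟩ := f.exists_norm_apply_le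
  exact AddMonoidHomClass.continuous_of_bound τ C hC

/-- The values of a normalized trace on the matrix units of `ℱ_n^k` are forced. -/
theorem IsNormalizedTrace.apply_fword {τ : core n →ₗ[ℂ] ℂ}
    (h : IsNormalizedTrace τ) {k : ℕ} (E : (Fin k → Fin n) → (Fin k → Fin n) → core n)
    (hE : ∀ μ ν, (E μ ν : CuntzAlgebra n) = fword μ * star (fword ν)) (μ ν : Fin k → Fin n) :
    τ (E μ ν) = if μ = ν then ((n : ℂ) ^ k)⁻¹ else 0 := by
  have hmul (μ ν κ ρ) : E μ ν * E κ ρ = if ν = κ then E μ ρ else 0 := by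
    apply Subtype.ext
    rw [MulMemClass.coe_mul, hE, hE, mul_assoc, ← mul_assoc (star (fword ν)),
      star_fword_mul_fword]
    split_ifs
    · rw [one_mul, hE]
    · simp
  have hdiag (μ ν) : τ (E μ μ) = τ (E ν ν) := by
    have := h.map_mul_comm (E μ ν) (E ν μ)
    simpa [hmul] using this
  have hsum : ∑ μ, E μ μ = 1 := by
    apply Subtype.ext
    rw [AddSubmonoidClass.coe_finsetSum]
    simp only [hE]
    exact sum_fword_mul_star n k
  split_ifs with hμ
  · subst hμ
    have h1 : (n : ℂ) ^ k * τ (E μ μ) = 1 := by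
      rw [← h.map_one, ← hsum, map_sum, Finset.sum_congr rfl fun ν _ => hdiag ν μ]
      simp
    exact eq_inv_of_mul_eq_one_right h1
  · have := h.map_mul_comm (E μ ν) (E ν ν)
    simpa [hmul, Ne.symm hμ] using this

theorem IsNormalizedTrace.eq {τ τ' : core n →ₗ[ℂ] ℂ} (h : IsNormalizedTrace τ)
    (h' : IsNormalizedTrace τ') : τ' = τ := by
  have hlevel (k : ℕ) (x : core n) (hx : (x : CuntzAlgebra n) ∈ coreLevel n k) :
      τ' x = τ x := by
    obtain ⟨c, hc⟩ := eq_sum_of_mem_coreLevel hx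
    let E (μ ν : Fin k → Fin n) : core n :=
      ⟨fword μ * star (fword ν), coreLevel_le_core k (fword_mul_star_mem_coreLevel μ ν)⟩
    have hx : x = ∑ μ, ∑ ν, c μ ν • E μ ν := by
      apply Subtype.ext
      simp only [AddSubmonoidClass.coe_finsetSum]
      exact hc
    simp only [hx, map_sum, map_smul, h.apply_fword E (fun _ _ => rfl),
      h'.apply_fword E (fun _ _ => rfl)]
  have hd : Dense {x : core n | ∃ k, (x : CuntzAlgebra n) ∈ coreLevel n k} := by
    intro x
    rw [closure_subtype]
    have hx : (x : CuntzAlgebra n) ∈ (core n : Set (CuntzAlgebra n)) := x.2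
    rw [core_eq_closure_iUnion] at hx
    refine closure_mono (Set.iUnion_subset fun k y hy => ?_) hx
    exact ⟨⟨y, coreLevel_le_core k hy⟩, ⟨k, hy⟩, rfl⟩
  exact DFunLike.coe_injective
    (h'.continuous.ext_on hd h.continuous fun x ⟨k, hk⟩ => hlevel k x hk)

/-- The restriction of `λ_u`, for `u ∈ ℱ_n`, to a unital `*`-endomorphism of `ℱ_n`. -/
def coreEndo (u : unitary (CuntzAlgebra n)) (hu : (u : CuntzAlgebra n) ∈ core n) :
    core n →⋆ₐ[ℂ] core n :=
  ((endo u).comp (core n).subtype).codRestrict (core n) fun x => endo_mem_core hu x.2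

theorem coe_coreEndo {u : unitary (CuntzAlgebra n)} (hu : (u : CuntzAlgebra n) ∈ core n)
    (x : core n) : (coreEndo u hu x : CuntzAlgebra n) = endo u x := rfl

theorem IsNormalizedTrace.comp {τ : core n →ₗ[ℂ] ℂ} (h : IsNormalizedTrace τ)
    (ρ : core n →⋆ₐ[ℂ] core n) : IsNormalizedTrace (τ ∘ₗ ρ.toAlgHom.toLinearMap) where
  map_one := by
    change τ (ρ 1) = 1
    rw [_root_.map_one ρ, h.map_one]
  nonneg x := by
    change 0 ≤ τ (ρ (star x * x))
    rw [map_mul ρ, map_star ρ]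
    exact h.nonneg _
  map_mul_comm x y := by
    change τ (ρ (x * y)) = τ (ρ (y * x))
    rw [map_mul ρ, map_mul ρ, h.map_mul_comm]

/-- Every unital `*`-endomorphism of `ℱ_n` preserves the trace, by uniqueness of the trace. -/
theorem IsNormalizedTrace.apply_starAlgHom {τ : core n →ₗ[ℂ] ℂ} (h : IsNormalizedTrace τ)
    (ρ : core n →⋆ₐ[ℂ] core n) (x : core n) : τ (ρ x) = τ x :=
  LinearMap.congr_fun (h.eq (h.comp ρ)) x

theorem coe_starSubalgebra_inclusion {R A : Type*} [CommSemiring R] [StarRing R] [Semiring A]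
    [Algebra R A] [StarRing A] [StarModule R A] {S₁ S₂ : StarSubalgebra R A} (h : S₁ ≤ S₂)
    (x : S₁) : (StarSubalgebra.inclusion h x : A) = x := rfl

theorem coe_diagToCore (x : diag n) : (diagToCore n x : CuntzAlgebra n) = x :=
  coe_starSubalgebra_inclusion (diag_le_core n) x

theorem coreEndo_diagToCore {α : diag n ≃⋆ₐ[ℂ] diag n} {u : unitary (CuntzAlgebra n)}
    (hu : (u : CuntzAlgebra n) ∈ core n)
    (h : ∀ x : diag n, (α x : CuntzAlgebra n) = endo u x) (x : diag n) :
    coreEndo u hu (diagToCore n x) = diagToCore n (α x) := by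
  apply Subtype.ext
  rw [coe_coreEndo, coe_diagToCore, coe_diagToCore, h]

end Cuntz

theorem theorem3p4 (n : ℕ) (hn : 2 ≤ n) (α : Cuntz.diag n ≃⋆ₐ[ℂ] Cuntz.diag n) :
    (Cuntz.PropertyP α.symm ↔
      ∃ u ∈ Cuntz.permUnitaries n,
        ∀ x : Cuntz.diag n, (α x : Cuntz.CuntzAlgebra n) = Cuntz.endo u x) ∧
    (Cuntz.PropertyP α.symm →
      (∃ ρ : Cuntz.core n →⋆ₐ[ℂ] Cuntz.core n,
        ∀ x : Cuntz.diag n, ρ (Cuntz.diagToCore n x) = Cuntz.diagToCore n (α x)) ∧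
      -- `τ` below is the unique normalized trace of `ℱ_n`
      ∃ τ : Cuntz.core n →ₗ[ℂ] ℂ, Cuntz.IsNormalizedTrace τ ∧
        (∀ τ' : Cuntz.core n →ₗ[ℂ] ℂ, Cuntz.IsNormalizedTrace τ' → τ' = τ) ∧
        ∀ x : Cuntz.diag n,
          τ (Cuntz.diagToCore n (α x)) = τ (Cuntz.diagToCore n x) ∧
          τ (Cuntz.diagToCore n (α.symm x)) = τ (Cuntz.diagToCore n x)) := by
  have hn0 : n ≠ 0 := by omega
  refine ⟨⟨Cuntz.exists_permUnitary_of_propertyP hn0, ?_⟩, fun h => ?_⟩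
  · rintro ⟨u, hu, h⟩
    obtain ⟨k, hk⟩ := Cuntz.exists_mem_coreLevel_of_mem_permUnitaries hu
    exact Cuntz.propertyP_symm_of_eq_endo hk h
  · obtain ⟨u, hu, h⟩ := Cuntz.exists_permUnitary_of_propertyP hn0 h
    have hρ := Cuntz.coreEndo_diagToCore hu.2 h
    obtain ⟨τ, hτ⟩ := Cuntz.exists_isNormalizedTrace hn0
    have hinv (x : Cuntz.diag n) :
        τ (Cuntz.diagToCore n (α x)) = τ (Cuntz.diagToCore n x) := by
      rw [← hρ, hτ.apply_starAlgHom]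
    refine ⟨⟨Cuntz.coreEndo u hu.2, hρ⟩, τ, hτ, fun τ' hτ' => hτ.eq hτ', fun x =>
      ⟨hinv x, ?_⟩⟩
    rw [← hinv, α.apply_symm_apply]

end
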